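/- Let $k$ be a field and let $\mathscr{C}$ be a $k$-linear $\operatorname{Hom}$-finite triangulated category with split idempotents and ($k$-linear) suspension functor $\Sigma$. For an object $t$, $\operatorname{add}(t)$ denotes the full subcategory of direct summands of finite direct sums of copies of $t$. For an integer $n \geqslant 1$, a full subcategory $\mathscr{X} \subseteq \mathscr{C}$ is called $n$-cluster tilting if it is functorially finite and \[ \mathscr{X} = \{ c \in \mathscr{C} \mid \mathscr{C}(x,\Sigma^i c)=0 \text{ for all } x \in \mathscr{X},\ 1 \leqslant i \leqslant n-1 \} = \{ c \in \mathscr{C} \mid \mathscr{C}(c,\Sigma^i x)=0 \text{ for all } x \in \mathscr{X},\ 1 \leqslant i \leqslant n-1 \}. \] Let $d \geqslant 1$ be an integer, let $\mathscr{S} \subseteq \mathscr{C}$ be a $d$-cluster tilting subcategory with $\Sigma^d\mathscr{S} = \mathscr{S}$, and let $t \in \mathscr{S}$ be such that $\mathscr{T} = \operatorname{add}(t)$ is a $2d$-cluster tilting subcategory of $\mathscr{C}$. Set $\Gamma = \operatorname{End}_{\mathscr{C}}(t)$, let $\operatorname{mod}(\Gamma)$ be the category of finitely generated right $\Gamma$-modules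 with Grothendieck group $\operatorname{K}_0(\operatorname{mod}\Gamma)$ (modulo short exact sequences), let $F = \mathscr{C}(t,-) : \mathscr{C} \to \operatorname{mod}(\Gamma)$, and let $\operatorname{K}_0^{\operatorname{sp}}(\mathscr{T})$ be the split Grothendieck group of $\mathscr{T}$. A $(d+2)$-angle in $\mathscr{S}$ (for the standard $(d+2)$-angulated structure) is a sequence $s_{d+1} \to s_d \to \cdots \to s_0 \xrightarrow{\gamma} \Sigma^d s_{d+1}$ with all $s_i \in \mathscr{S}$ for which there are objects $w_0 = s_0, w_1, \ldots, w_{d-1}, w_d = s_{d+1}$ of $\mathscr{C}$ and triangles $w_i \to s_i \to w_{i-1} \xrightarrow{\delta_{i-1}} \Sigma w_i$ for $1 \leqslant i \leqslant d$ such that the first and last morphisms $s_{d+1} \to s_d$ and $s_1 \to s_0$ are the morphisms $w_d \to s_d$ and $s_1 \to w_0$ of these triangles, each other morphism $s_{i+1} \to s_i$ is the composition $s_{i+1} \to w_i \to s_i$, and $\gamma = \Sigma^{d-1}(\delta_{d-1}) \circ \cdots \circ \Sigma(\delta_1) \circ \delta_0$. For $s \in \mathscr{S}$ let $t_d \xrightarrow{\tau_d}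 \cdots \xrightarrow{\tau_1} t_0 \to s \to \Sigma^d t_d$ be a $(d+2)$-angle in $\mathscr{S}$ with all $t_i \in \mathscr{T}$ and all $\tau_i$ in the radical of $\mathscr{S}$, and set \[ \operatorname{index}^{\pentagon}_{\mathscr{T}}(s) = \sum_{i=0}^{d} (-1)^i [t_i] \in \operatorname{K}_0^{\operatorname{sp}}(\mathscr{T}). \] Then such a $(d+2)$-angle exists for each $s \in \mathscr{S}$ and $\operatorname{index}^{\pentagon}_{\mathscr{T}}(s)$ does not depend on its choice. Moreover, there is a unique homomorphism of abelian groups $\theta : \operatorname{K}_0(\operatorname{mod}\Gamma) \to \operatorname{K}_0^{\operatorname{sp}}(\mathscr{T})$ such that for every $(d+2)$-angle $s_{d+1} \to \cdots \to s_0 \xrightarrow{\gamma} \Sigma^d s_{d+1}$ in $\mathscr{S}$, \[ \sum_{i=0}^{d+1} (-1)^i \operatorname{index}^{\pentagon}_{\mathscr{T}}(s_i) = \theta\big( [\operatorname{Im} F\gamma] \big). \] -/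

import Mathlib

open CategoryTheory CategoryTheory.Limits CategoryTheory.Pretriangulated

noncomputable section

namespace HigherIndex

universe v u w

/-! ### Grothendieck groups -/

section ModuleK0

variable (R : Type w) [Ring R]

/-- The subgroup generated by the elements `[L] - [K] - [M]`, for short exact sequences
`0 ⟶ K ⟶ L ⟶ M ⟶ 0` of finitely generated left `R`-modules. -/
def k0Relations : AddSubgroup (FreeAbelianGroup (FGModuleCat.{v} R)) :=
  AddSubgroup.closure
    {x | ∃ (K L M : FGModuleCat.{v} R) (f : K.obj →ₗ[R] L.obj) (g : L.obj →ₗ[R] M.obj),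
      Function.Injective f ∧ Function.Exact f g ∧ Function.Surjective g ∧
      x = FreeAbelianGroup.of L - FreeAbelianGroup.of K - FreeAbelianGroup.of M}

/-- The Grothendieck group of the category of finitely generated left `R`-modules
(modulo short exact sequences).  Right `Γ`-modules are the left modules over `R = Γᵐᵒᵖ`. -/
abbrev K0 : Type (max w (v + 1)) :=
  FreeAbelianGroup (FGModuleCat.{v} R) ⧸ k0Relations.{v} R

variable {R} in
/-- The class `[M]` of a finitely generated module in the Grothendieck group. -/
def K0.cls (M : FGModuleCat.{v} R) : K0.{v} R :=
  QuotientAddGroup.mk (FreeAbelianGroup.of M)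

end ModuleK0

section SplitK0

variable {C : Type u} [Category.{v} C] [Preadditive C] [HasBinaryBiproducts C]

/-- The subgroup generated by the elements `[X] - [Y] - [Z]`, for objects `X ≅ Y ⊕ Z` of the full
subcategory `P`. -/
def splitK0Relations (P : ObjectProperty C) : AddSubgroup (FreeAbelianGroup P.FullSubcategory) :=
  AddSubgroup.closure
    {x | ∃ X Y Z : P.FullSubcategory, Nonempty (X.obj ≅ Y.obj ⊞ Z.obj) ∧
      x = FreeAbelianGroup.of X - FreeAbelianGroup.of Y - FreeAbelianGroup.of Z}

/-- The split Grothendieck group of the full subcategory `P` (used for additive subcategories;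
since these contain a zero object, isomorphic objects have the same class). -/
abbrev SplitK0 (P : ObjectProperty C) : Type u :=
  FreeAbelianGroup P.FullSubcategory ⧸ splitK0Relations P

/-- The class `[X]` of an object of `P` in the split Grothendieck group. -/
def SplitK0.cls {P : ObjectProperty C} (X : C) (hX : P X) : SplitK0 P :=
  QuotientAddGroup.mk (FreeAbelianGroup.of (⟨X, hX⟩ : P.FullSubcategory))

end SplitK0

/-! ### Additive closure, radical, approximations -/

section Additive

variable {C : Type u} [Category.{v} C] [Preadditive C]

/-- `add t`: the direct summands of finite direct sums of copies of `t`. -/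
def addClosure [HasFiniteBiproducts C] (t : C) : ObjectProperty C :=
  fun c => ∃ n : ℕ, Nonempty (Retract c (⨁ fun _ : Fin n => t))

/-- The morphism `f` belongs to the (Jacobson) radical of the category. -/
def InRadical {X Y : C} (f : X ⟶ Y) : Prop :=
  ∀ g : Y ⟶ X, IsIso (𝟙 X - f ≫ g)

/-- The full subcategory `P` is functorially finite: every object has a right
and a left `P`-approximation. -/
def FunctoriallyFinite (P : ObjectProperty C) : Prop :=
  (∀ c : C, ∃ (p : C) (f : p ⟶ c), P p ∧
    ∀ (q : C) (g : q ⟶ c), P q → ∃ h : q ⟶ p, h ≫ f = g) ∧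
  (∀ c : C, ∃ (p : C) (f : c ⟶ p), P p ∧
    ∀ (q : C) (g : c ⟶ q), P q → ∃ h : p ⟶ q, f ≫ h = g)

/-- The full subcategory `P` is `n`-cluster tilting: it is functorially finite and
`P = {c | Ext^{1..n-1}(P, c) = 0} = {c | Ext^{1..n-1}(c, P) = 0}`,
where `Ext^i(x, y) = Hom(x, Σ^i y)`. -/
def IsClusterTilting [HasShift C ℤ] (n : ℕ) (P : ObjectProperty C) : Prop :=
  FunctoriallyFinite P ∧
  (∀ c : C, P c ↔
    ∀ p : C, P p → ∀ i : ℕ, 1 ≤ i → i + 1 ≤ n → ∀ f : p ⟶ c⟦(i : ℤ)⟧, f = 0) ∧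
  (∀ c : C, P c ↔
    ∀ p : C, P p → ∀ i : ℕ, 1 ≤ i → i + 1 ≤ n → ∀ f : c ⟶ p⟦(i : ℤ)⟧, f = 0)

end Additive

/-! ### The functor `F = Hom(t, -)` -/

section HomFunctor

variable (k : Type w) [Field k] {C : Type u} [Category.{v} C] [Preadditive C] [Linear k C]

/-- If `Hom(t, c)` is finite dimensional, then it is a finitely generated right module
over the endomorphism algebra of `t`. -/
theorem finite_hom (t c : C) [Module.Finite k (t ⟶ c)] :
    Module.Finite (End t)ᵐᵒᵖ ((preadditiveCoyonedaObj t).obj c) := by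
  obtain ⟨s, hs⟩ := Module.finite_def.1 (inferInstance : Module.Finite k (t ⟶ c))
  refine ⟨⟨s, ?_⟩⟩
  rw [eq_top_iff]
  rintro (x : t ⟶ c) -
  have hx : x ∈ Submodule.span k (s : Set (t ⟶ c)) := by rw [hs]; trivial
  induction hx using Submodule.span_induction with
  | mem x h => exact Submodule.subset_span h
  | zero => exact Submodule.zero_mem _
  | add x y _ _ hx hy => exact Submodule.add_mem _ hx hy
  | smul a x _ hx =>
    have h : (a • x : t ⟶ c) = (a • 𝟙 t) ≫ x := by simp
    rw [h]
    exact Submodule.smul_mem _ (MulOpposite.op (show End t from a • 𝟙 t)) hx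

/-- The finitely generated right `End t`-module `Im Fγ`, where `F = Hom(t, -)`. -/
def imageF (t : C) {x y : C} [Module.Finite k (t ⟶ x)] (γ : x ⟶ y) :
    FGModuleCat.{v} (End t)ᵐᵒᵖ :=
  haveI := finite_hom k t x
  FGModuleCat.of (End t)ᵐᵒᵖ (LinearMap.range ((preadditiveCoyonedaObj t).map γ).hom)

end HomFunctor

/-! ### `(d+2)`-angles and the index -/

section Angles

variable (C : Type u) [Category.{v} C] [HasShift C ℤ]

/-- A sequence of objects and morphisms
`s_{d+1} ⟶ s_d ⟶ ⋯ ⟶ s_1 ⟶ s_0 ⟶ Σ^d s_{d+1}`.  Here `obj i` is `s_i`, `map i` is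
the morphism `s_{i+1} ⟶ s_i`, and `conn` is the last morphism. -/
structure AngleSeq (d : ℕ) where
  obj : Fin (d + 2) → C
  map : (i : Fin (d + 1)) → (obj i.succ ⟶ obj i.castSucc)
  conn : obj 0 ⟶ (obj (Fin.last (d + 1)))⟦(d : ℤ)⟧

variable {C}

/-- The composition `w_0 ⟶ Σ w_1 ⟶ Σ² w_2 ⟶ ⋯ ⟶ Σ^j w_j` of the suspensions of
morphisms `δ_i : w_i ⟶ Σ w_{i+1}`. -/
def composeShifted {d : ℕ} (w : Fin (d + 1) → C)
    (δ : (i : Fin d) → (w i.castSucc ⟶ (w i.succ)⟦(1 : ℤ)⟧)) :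
    (j : ℕ) → (hj : j < d + 1) → (w 0 ⟶ (w ⟨j, hj⟩)⟦(j : ℤ)⟧)
  | 0, _ => (shiftFunctorZero C ℤ).inv.app (w 0)
  | j + 1, hj =>
      composeShifted w δ j (Nat.lt_of_succ_lt hj) ≫
        (δ ⟨j, Nat.lt_of_succ_lt_succ hj⟩)⟦(j : ℤ)⟧' ≫
          (shiftFunctorAdd' C (1 : ℤ) (j : ℤ) ((j + 1 : ℕ) : ℤ) (by push_cast; ring)).inv.app _

variable [Preadditive C] [HasZeroObject C] [∀ n : ℤ, (shiftFunctor C n).Additive]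
  [Pretriangulated C]

/-- A tower of triangles realising the sequence `A`.  The object `w i` is the vertex `v_{i+1/2}`
of the tower, with `w 0 ≅ s_0` and `w d ≅ s_{d+1}`; the triangles are
`w_{i+1} ⟶ s_{i+1} ⟶ w_i ⟶ Σ w_{i+1}` for `0 ≤ i < d`; each morphism `s_{i+1} ⟶ s_i` is the
composition `s_{i+1} ⟶ w_i ⟶ s_i`; and the last morphism `s_0 ⟶ Σ^d s_{d+1}` is the composition
of the suspensions of the connecting morphisms of the triangles. -/
structure Tower {d : ℕ} (A : AngleSeq C d) where
  w : Fin (d + 1) → C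
  a : (i : Fin (d + 1)) → (w i ⟶ A.obj i.castSucc)
  b : (i : Fin (d + 1)) → (A.obj i.succ ⟶ w i)
  δ : (i : Fin d) → (w i.castSucc ⟶ (w i.succ)⟦(1 : ℤ)⟧)
  isIso_a : IsIso (a 0)
  isIso_b : IsIso (b (Fin.last d))
  distinguished : ∀ i : Fin d,
    Triangle.mk (a i.succ) (b i.castSucc) (δ i) ∈ distTriang C
  comm : ∀ i : Fin (d + 1), A.map i = b i ≫ a i
  conn_eq : a 0 ≫ A.conn =
    composeShifted w δ d (Nat.lt_succ_self d) ≫ (inv (b (Fin.last d)))⟦(d : ℤ)⟧'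

/-- The sequence `A` is a `(d+2)`-angle in the standard structure on the full subcategory `S`
of the triangulated category `C`. -/
def IsAngle (S : ObjectProperty C) {d : ℕ} (A : AngleSeq C d) : Prop :=
  (∀ i, S (A.obj i)) ∧ Nonempty (Tower A)

variable [HasBinaryBiproducts C]

/-- `x` is the class `∑_{i=0}^d (-1)^i [t_i]` for some `(d+2)`-angle
`t_d ⟶ ⋯ ⟶ t_0 ⟶ s ⟶ Σ^d t_d` in `S` with all `t_i` in `T` and all morphisms
`t_i ⟶ t_{i-1}` in the radical. -/
def IsIndexOf (S T : ObjectProperty C) (d : ℕ) (s : C) (x : SplitK0 T) : Prop :=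
  ∃ (A : AngleSeq C d) (hT : ∀ i : Fin (d + 1), T (A.obj i.succ)),
    IsAngle S A ∧ Nonempty (A.obj 0 ≅ s) ∧
    (∀ i : Fin d, InRadical (A.map i.succ)) ∧
    x = ∑ i : Fin (d + 1), (-1 : ℤ) ^ (i : ℕ) • SplitK0.cls (A.obj i.succ) (hT i)

/-- The `(d+2)`-angulated index of `s` with respect to `T` (an arbitrary value if there is no
minimal resolution of `s` as in `IsIndexOf`). -/
def index (S T : ObjectProperty C) (d : ℕ) (s : C) : SplitK0 T :=
  Classical.epsilon (IsIndexOf S T d s)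

end Angles

end HigherIndex

end

open CategoryTheory CategoryTheory.Limits CategoryTheory.Pretriangulated

noncomputable section

namespace HigherIndex

universe v u w

open Triangulated ZeroObject

/-! ### Morphisms and the functor `Hom(t, -)` -/

section HomMorphisms

variable {C : Type u} [Category.{v} C] {t : C}

/-! The proof passes through an index on the whole triangulated category. Write F = Hom(t, -). If c
satisfies Hom(t, Σ^i c) = 0 for 1 ≤ i ≤ j, the fibre of an add(t)-precover of c satisfies this for 1
≤ i ≤ j + 1, and for j = 2d - 1 the condition means membership in add(t). Descending on j,
`exists_index_step` extends the class map from add(t) to all objects by setting ind(c) = ind(P) -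
ind(K) for a precover P → c with fibre K. Octahedral (Schanuel) arguments show that the resulting
`ind` is additive on every triangle whose connecting morphism is killed by F.

On other triangles additivity fails by the `defect` of the connecting morphism. The defect is
unchanged by precomposition with F-epimorphisms and postcomposition with F-monomorphisms. So if g
factors, up to F-epimorphism, through an object m with F m ≅ Im F g, its defect equals that of the
identity of m, namely ind(m) + ind(Σ⁻¹ m). This depends only on the module F m and is additive on
short exact sequences of modules, which gives θ with θ[Im F g] = defect(g) (`exists_theta`).

In the tower of a (d+2)-angle in S, Ext-vanishing makes F kill every connecting morphism except δ_0.
The alternating sum of the indices therefore telescopes to the defect of δ_0. The same vanishing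
gives ker F γ = ker F δ_0, so this defect is θ[Im F γ] (`Tower.alternating_sum_eq`). For an angle
resolving s by objects of add(t), F γ = 0 because Hom(t, Σ^d t_d) = 0. Hence ind(s) is the
alternating sum of the classes [t_i], and the index of the theorem is the restriction of `ind` to S
(`IsIndexOf.eq_index`).

Minimal resolutions come from iterating right minimal precovers. For uniqueness of θ, a projective
presentation of a module M is F of a morphism in add(t). Completing that morphism to an angle in S
gives Im F γ ≅ M (`exists_angle_imageF`), so θ is determined on all classes. -/

/-- The morphism `f` is sent to a surjection by the functor `Hom(t, -)`. -/
def EpiOn (t : C) {p c : C} (f : p ⟶ c) : Prop := ∀ g : t ⟶ c, ∃ h : t ⟶ p, h ≫ f = g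

lemma epiOn_of_isIso {x y : C} (f : x ⟶ y) [IsIso f] : EpiOn t f := fun u =>
  ⟨u ≫ inv f, by rw [Category.assoc, IsIso.inv_hom_id, Category.comp_id]⟩

variable [Preadditive C]

/-- The morphism `δ` is killed by the functor `Hom(t, -)`. -/
def NullOn (t : C) {c x : C} (δ : c ⟶ x) : Prop := ∀ g : t ⟶ c, g ≫ δ = 0

/-- The morphism `f` is sent to an injection by the functor `Hom(t, -)`. -/
def MonoOn (t : C) {c x : C} (f : c ⟶ x) : Prop := ∀ g : t ⟶ c, g ≫ f = 0 → g = 0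

lemma NullOn.comp {a b c : C} {g : b ⟶ c} (h : NullOn t g) (f : a ⟶ b) : NullOn t (f ≫ g) :=
  fun u => by rw [← Category.assoc, h]

lemma NullOn.comp' {a b c : C} {f : a ⟶ b} (h : NullOn t f) (g : b ⟶ c) : NullOn t (f ≫ g) :=
  fun u => by rw [← Category.assoc, h, zero_comp]

lemma MonoOn.comp {x y z : C} {f : x ⟶ y} {g : y ⟶ z} (hf : MonoOn t f) (hg : MonoOn t g) :
    MonoOn t (f ≫ g) := fun u hu => hf u (hg _ (by rwa [Category.assoc]))

lemma monoOn_of_mono {x y : C} (f : x ⟶ y) [Mono f] : MonoOn t f := fun u hu => by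
  rwa [← cancel_mono f, zero_comp]

end HomMorphisms

/-! ### Additive closures -/

section AddClosure

variable {C : Type u} [Category.{v} C] [Preadditive C] [HasFiniteBiproducts C] {t : C}

lemma addClosure_biproduct (t : C) (n : ℕ) : addClosure t (⨁ fun _ : Fin n => t) :=
  ⟨n, ⟨Retract.refl _⟩⟩

lemma addClosure_self (t : C) : addClosure t t := by
  refine ⟨1, ⟨⟨biproduct.ι (fun _ : Fin 1 => t) 0, biproduct.π (fun _ : Fin 1 => t) 0, ?_⟩⟩⟩
  simp

lemma addClosure_of_retract {x y : C} (r : Retract x y) (hy : addClosure t y) :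
    addClosure t x := by
  obtain ⟨n, ⟨s⟩⟩ := hy
  exact ⟨n, ⟨r.trans s⟩⟩

/-- Maps out of a sum of copies of t are tested on the inclusions of t, and a retract inherits this.
It is what turns statements about F into equalities of morphisms. -/
lemma NullOn.eq_zero {c x : C} {δ : c ⟶ x} (h : NullOn t δ) (hc : addClosure t c) : δ = 0 := by
  obtain ⟨n, ⟨r⟩⟩ := hc
  have : r.r ≫ δ = 0 := by
    ext j
    rw [← Category.assoc, h, comp_zero]
  rw [← Category.id_comp δ, ← r.retract, Category.assoc, this, comp_zero]

lemma EpiOn.exists_lift {p c q : C} {f : p ⟶ c} (hf : EpiOn t f) (hq : addClosure t q)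
    (g : q ⟶ c) : ∃ h : q ⟶ p, h ≫ f = g := by
  obtain ⟨n, ⟨r⟩⟩ := hq
  choose h hh using fun j : Fin n => hf (biproduct.ι (fun _ : Fin n => t) j ≫ r.r ≫ g)
  refine ⟨r.i ≫ biproduct.desc h, ?_⟩
  have : biproduct.desc h ≫ f = r.r ≫ g := by
    ext j
    simp [hh]
  rw [Category.assoc, this, r.retract_assoc]

end AddClosure

/-! ### Vanishing of shifted morphisms -/

section Vanishing

variable {C : Type u} [Category.{v} C] [Preadditive C] {t : C}

lemma hom_zero_of_iso {x y : C} (e : x ≅ y) (h : ∀ u : t ⟶ x, u = 0) (u : t ⟶ y) : u = 0 := by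
  rw [← Category.comp_id u, ← e.inv_hom_id, ← Category.assoc, h (u ≫ e.inv), zero_comp]

variable [HasShift C ℤ]

/-- `Hom(t, Σ^i c) = 0` for `1 ≤ i ≤ j`. -/
def ExtVanish (t : C) (j : ℕ) (c : C) : Prop :=
  ∀ i : ℕ, 1 ≤ i → i ≤ j → ∀ f : t ⟶ c⟦(i : ℤ)⟧, f = 0

lemma ExtVanish.mono {j j' : ℕ} {c : C} (h : ExtVanish t j c) (hj : j' ≤ j) :
    ExtVanish t j' c := fun i h1 h2 => h i h1 (h2.trans hj)

end Vanishing

/-! ### Triangles and the functor `Hom(t, -)` -/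

section Triangles

variable {C : Type u} [Category.{v} C] [Preadditive C] [HasZeroObject C] [HasShift C ℤ]
  [∀ n : ℤ, (shiftFunctor C n).Additive] [Pretriangulated C] {t : C}

lemma comp_zero₁₂ {a b c : C} {f : a ⟶ b} {g : b ⟶ c} {δ : c ⟶ a⟦(1 : ℤ)⟧}
    (h : Triangle.mk f g δ ∈ distTriang C) : f ≫ g = 0 :=
  comp_distTriang_mor_zero₁₂ _ h

lemma comp_zero₂₃ {a b c : C} {f : a ⟶ b} {g : b ⟶ c} {δ : c ⟶ a⟦(1 : ℤ)⟧}
    (h : Triangle.mk f g δ ∈ distTriang C) : g ≫ δ = 0 :=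
  comp_distTriang_mor_zero₂₃ _ h

lemma nullOn_iff_epiOn {a b c : C} {f : a ⟶ b} {g : b ⟶ c} {δ : c ⟶ a⟦(1 : ℤ)⟧}
    (h : Triangle.mk f g δ ∈ distTriang C) : NullOn t δ ↔ EpiOn t g := by
  constructor
  · intro hδ u
    obtain ⟨v, hv⟩ := Triangle.coyoneda_exact₃ _ h u (hδ u)
    exact ⟨v, hv.symm⟩
  · intro hg u
    obtain ⟨v, rfl⟩ := hg u
    rw [Category.assoc, comp_zero₂₃ h, comp_zero]

lemma nullOn_iff_monoOn {a b c : C} {f : a ⟶ b} {g : b ⟶ c} {δ : c ⟶ a⟦(1 : ℤ)⟧}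
    (h : Triangle.mk f g δ ∈ distTriang C) : NullOn t f ↔ MonoOn t g := by
  constructor
  · intro hf u hu
    obtain ⟨v, hv⟩ := Triangle.coyoneda_exact₂ _ h u hu
    rw [hv]
    exact hf v
  · intro hg u
    apply hg
    rw [Category.assoc, comp_zero₁₂ h, comp_zero]

/-- Rotating back a triangle whose last object is a suspension. -/
lemma exists_unrotate {b c a : C} (g : b ⟶ c) (δ : c ⟶ a⟦(1 : ℤ)⟧)
    {h : (a⟦(1 : ℤ)⟧) ⟶ b⟦(1 : ℤ)⟧} (hT : Triangle.mk g δ h ∈ distTriang C) :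
    ∃ f : a ⟶ b, Triangle.mk f g δ ∈ distTriang C := by
  -- The sign compensates for the one introduced by rotation.
  obtain ⟨f, hf⟩ := (shiftFunctor C (1 : ℤ)).map_surjective (-h)
  refine ⟨f, ?_⟩
  rw [rotate_distinguished_triangle]
  have : (Triangle.mk f g δ).rotate = Triangle.mk g δ h := by
    change Triangle.mk g δ (-((shiftFunctor C (1 : ℤ)).map f)) = _
    rw [hf, neg_neg]
  rw [this]
  exact hT

lemma rotate_mk {a b c : C} {f : a ⟶ b} {g : b ⟶ c} {δ : c ⟶ a⟦(1 : ℤ)⟧}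
    (h : Triangle.mk f g δ ∈ distTriang C) : Triangle.mk g δ (-(f⟦(1 : ℤ)⟧')) ∈ distTriang C :=
  rot_of_distTriang _ h

lemma exists_fiber {b c : C} (g : b ⟶ c) :
    ∃ (a : C) (f : a ⟶ b) (δ : c ⟶ a⟦(1 : ℤ)⟧), Triangle.mk f g δ ∈ distTriang C :=
  distinguished_cocone_triangle₁ g

/-- Exactness of `Hom(t, -)` in the middle of a shifted triangle. -/
lemma hom_shift_zero₂ {a b c : C} {f : a ⟶ b} {g : b ⟶ c} {δ : c ⟶ a⟦(1 : ℤ)⟧}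
    (h : Triangle.mk f g δ ∈ distTriang C) (i : ℤ)
    (ha : ∀ u : t ⟶ a⟦i⟧, u = 0) (hc : ∀ u : t ⟶ c⟦i⟧, u = 0) (u : t ⟶ b⟦i⟧) : u = 0 := by
  obtain ⟨v, hv⟩ := Triangle.coyoneda_exact₂ _ (Triangle.shift_distinguished _ h i) u (hc _)
  rw [hv, ha v]
  exact zero_comp

lemma hom_shift_zero₃ {a b c : C} {f : a ⟶ b} {g : b ⟶ c} {δ : c ⟶ a⟦(1 : ℤ)⟧}
    (h : Triangle.mk f g δ ∈ distTriang C) (i j : ℤ) (hij : i + 1 = j)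
    (ha : ∀ u : t ⟶ a⟦j⟧, u = 0) (hb : ∀ u : t ⟶ b⟦i⟧, u = 0) (u : t ⟶ c⟦i⟧) : u = 0 := by
  obtain ⟨v, hv⟩ := Triangle.coyoneda_exact₃ _ (Triangle.shift_distinguished _ h i) u
    (hom_zero_of_iso ((shiftFunctorAdd' C i 1 j hij).app a) ha _)
  rw [hv, hb v]
  exact zero_comp

lemma hom_shift_zero₁ {a b c : C} {f : a ⟶ b} {g : b ⟶ c} {δ : c ⟶ a⟦(1 : ℤ)⟧}
    (h : Triangle.mk f g δ ∈ distTriang C) (i j : ℤ) (hij : i + 1 = j)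
    (hb : ∀ u : t ⟶ b⟦j⟧, u = 0) (hc : ∀ u : t ⟶ c⟦i⟧, u = 0) (u : t ⟶ a⟦j⟧) : u = 0 := by
  refine hom_zero_of_iso ((shiftFunctorAdd' C i 1 j hij).app a).symm (fun u => ?_) u
  obtain ⟨v, hv⟩ := Triangle.coyoneda_exact₁ _ (Triangle.shift_distinguished _ h i) u
    (hom_zero_of_iso ((shiftFunctorAdd' C i 1 j hij).app b) hb _)
  rw [hv, hc v]
  exact zero_comp

lemma nullOn_of_epiOn_shift {a b c : C} {f : a ⟶ b} {g : b ⟶ c} {δ : c ⟶ a⟦(1 : ℤ)⟧}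
    (h : Triangle.mk f g δ ∈ distTriang C) (hg : NullOn t δ)
    (hb : ∀ u : t ⟶ b⟦(1 : ℤ)⟧, u = 0) (u : t ⟶ a⟦(1 : ℤ)⟧) : u = 0 := by
  obtain ⟨v, hv⟩ := Triangle.coyoneda_exact₁ _ h u (hb _)
  rw [hv]
  exact hg v

lemma ExtVanish.ext {j : ℕ} {a b c : C} {f : a ⟶ b} {g : b ⟶ c} {δ : c ⟶ a⟦(1 : ℤ)⟧}
    (h : Triangle.mk f g δ ∈ distTriang C) (ha : ExtVanish t j a) (hc : ExtVanish t j c) :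
    ExtVanish t j b := fun i h1 h2 => hom_shift_zero₂ h i (ha i h1 h2) (hc i h1 h2)

/-- Passing to the fibre of an F-epimorphism gains one degree: degree 1 of a vanishes because δ is
killed by F and b has no Ext there, and degree i + 1 of a is squeezed between degree i of c and
degree i + 1 of b. -/
lemma ExtVanish.fiber {j : ℕ} {a b c : C} {f : a ⟶ b} {g : b ⟶ c} {δ : c ⟶ a⟦(1 : ℤ)⟧}
    (h : Triangle.mk f g δ ∈ distTriang C) (hδ : NullOn t δ)
    (hb : ExtVanish t (j + 1) b) (hc : ExtVanish t j c) : ExtVanish t (j + 1) a := by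
  intro i h1 h2
  obtain rfl | h1' := h1.eq_or_lt
  · exact nullOn_of_epiOn_shift h hδ (hb 1 le_rfl (by omega))
  · obtain ⟨i, rfl⟩ : ∃ i', i = i' + 1 := ⟨i - 1, by omega⟩
    exact hom_shift_zero₁ h i _ (by push_cast; rfl) (hb _ h1 h2) (hc i (by omega) (by omega))

lemma ExtVanish.of_addClosure {q : C} {j : ℕ} {c : C} (ht : ExtVanish q j t)
    (hc : addClosure t c) : ExtVanish q j c := by
  intro i h1 h2 f
  obtain ⟨n, ⟨r⟩⟩ := hc
  have h0 : ∀ u : q ⟶ (⨁ fun _ : Fin n => t)⟦(i : ℤ)⟧, u = 0 := by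
    intro u
    have : 𝟙 ((⨁ fun _ : Fin n => t)⟦(i : ℤ)⟧) =
        ∑ k, (biproduct.π (fun _ : Fin n => t) k)⟦(i : ℤ)⟧' ≫
          (biproduct.ι (fun _ : Fin n => t) k)⟦(i : ℤ)⟧' := by
      rw [← (shiftFunctor C (i : ℤ)).map_id, ← biproduct.total, Functor.map_sum]
      simp
    rw [← Category.comp_id u, this, Preadditive.comp_sum]
    refine Finset.sum_eq_zero fun k _ => ?_
    rw [← Category.assoc, ht i h1 h2 (u ≫ _), zero_comp]
  rw [← Category.comp_id f, ← (shiftFunctor C (i : ℤ)).map_id, ← r.retract, Functor.map_comp,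
    ← Category.assoc, h0 (f ≫ _), zero_comp]

end Triangles

/-! ### The split Grothendieck group -/

section SplitGrothendieck

variable {C : Type u} [Category.{v} C] [Preadditive C] [HasZeroObject C] [HasShift C ℤ]
  [∀ n : ℤ, (shiftFunctor C n).Additive] [Pretriangulated C] {t : C}

lemma SplitK0.cls_of_iso {P : ObjectProperty C} {x y z : C} (hx : P x) (hy : P y) (hz : P z)
    (e : x ≅ y ⊞ z) : SplitK0.cls x hx = SplitK0.cls y hy + SplitK0.cls z hz := by
  have : (QuotientAddGroup.mk (FreeAbelianGroup.of (⟨x, hx⟩ : P.FullSubcategory) -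
      FreeAbelianGroup.of ⟨y, hy⟩ - FreeAbelianGroup.of ⟨z, hz⟩) : SplitK0 P) = 0 := by
    rw [QuotientAddGroup.eq_zero_iff]
    exact AddSubgroup.subset_closure ⟨_, _, _, ⟨e⟩, rfl⟩
  rw [QuotientAddGroup.mk_sub, QuotientAddGroup.mk_sub, sub_sub, sub_eq_zero] at this
  exact this

open Classical in
/-- The class of an object in the split Grothendieck group, extended by zero. -/
def splitClass (P : ObjectProperty C) (c : C) : SplitK0 P :=
  if h : P c then SplitK0.cls c h else 0

lemma splitClass_eq {P : ObjectProperty C} {c : C} (h : P c) :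
    splitClass P c = SplitK0.cls c h := dif_pos h

/-- The connecting morphism starts in add(t), so being killed by F makes it zero and the triangle
splits. -/
lemma splitClass_triangle {a b c : C} {f : a ⟶ b} {g : b ⟶ c} {δ : c ⟶ a⟦(1 : ℤ)⟧}
    (h : Triangle.mk f g δ ∈ distTriang C) (hδ : NullOn t δ) (ha : addClosure t a)
    (hb : addClosure t b) (hc : addClosure t c) :
    splitClass (addClosure t) b = splitClass (addClosure t) a + splitClass (addClosure t) c := by
  obtain ⟨e, -⟩ := exists_iso_binaryBiproduct_of_distTriang _ h (hδ.eq_zero hc)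
  rw [splitClass_eq ha, splitClass_eq hb, splitClass_eq hc]
  exact SplitK0.cls_of_iso _ _ _ e

end SplitGrothendieck

/-! ### The index on the triangulated category -/

section Index

variable {C : Type u} [Category.{v} C] [Preadditive C] [HasZeroObject C] [HasShift C ℤ]
  [∀ n : ℤ, (shiftFunctor C n).Additive] [Pretriangulated C] {t : C}

/-- The function `ind` is additive on the triangles whose last morphism is killed by
`Hom(t, -)` and whose objects satisfy the given property. -/
def AdditiveOn (t : C) (P : C → Prop) {G : Type*} [AddCommGroup G] (ind : C → G) : Prop :=
  ∀ ⦃a b c : C⦄ ⦃f : a ⟶ b⦄ ⦃g : b ⟶ c⦄ ⦃δ : c ⟶ a⟦(1 : ℤ)⟧⦄,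
    Triangle.mk f g δ ∈ distTriang C → NullOn t δ → P a → P b → P c → ind b = ind a + ind c

variable {P : C → Prop} {G : Type*} [AddCommGroup G] {ind : C → G}

lemma AdditiveOn.zero (h : AdditiveOn t P ind) {z : C} (hz : IsZero z) (hP : P z) :
    ind z = 0 := by
  have := h (a := z) (b := z) (c := z) (f := 𝟙 z) (g := 0) (δ := 0) (by
    refine isomorphic_distinguished _ (contractible_distinguished z) _ ?_
    exact Triangle.isoMk _ _ (Iso.refl _) (Iso.refl _) (hz.iso (isZero_zero C))
      rfl (hz.eq_of_src _ _) (hz.eq_of_src _ _))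
    (fun g => by simp) hP hP hP
  simpa using this

/-- Every object has a precover in the additive closure of `t`. -/
def HasPrecovers (t : C) : Prop :=
  ∀ c : C, ∃ (p : C) (f : p ⟶ c), addClosure t p ∧ EpiOn t f

lemma HasPrecovers.exists_triangle (hp : HasPrecovers t) (c : C) :
    ∃ (a p : C) (f : a ⟶ p) (g : p ⟶ c) (δ : c ⟶ a⟦(1 : ℤ)⟧), addClosure t p ∧
      Triangle.mk f g δ ∈ distTriang C ∧ NullOn t δ := by
  obtain ⟨p, g, hp, hg⟩ := hp c
  obtain ⟨a, f, δ, h⟩ := exists_fiber g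
  exact ⟨a, p, f, g, δ, hp, h, (nullOn_iff_epiOn h).2 hg⟩

variable [IsTriangulated C]

/-- The pullback of two precovers: two triangles with the same third object. -/
lemma exists_pullback {a b c a' b' : C} {f : a ⟶ b} {g : b ⟶ c} {δ : c ⟶ a⟦(1 : ℤ)⟧}
    {f' : a' ⟶ b'} {g' : b' ⟶ c} {δ' : c ⟶ a'⟦(1 : ℤ)⟧}
    (h : Triangle.mk f g δ ∈ distTriang C) (h' : Triangle.mk f' g' δ' ∈ distTriang C) :
    ∃ (p : C) (i : a ⟶ p) (q : p ⟶ b') (i' : a' ⟶ p) (q' : p ⟶ b),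
      Triangle.mk i q (g' ≫ δ) ∈ distTriang C ∧ Triangle.mk i' q' (g ≫ δ') ∈ distTriang C := by
  obtain ⟨p, q, ε, hp⟩ := exists_fiber (g' ≫ δ)
  obtain ⟨i, hi⟩ := exists_unrotate _ _ hp
  let o := someOctahedron' rfl h' (rotate_mk h) hp
  exact ⟨p, i, q, _, _, hi, o.mem⟩

/-- Additivity over a pair of precovers. -/
lemma AdditiveOn.schanuel {j : ℕ} (hind : AdditiveOn t (ExtVanish t j) ind)
    {a b c a' b' : C} {f : a ⟶ b} {g : b ⟶ c} {δ : c ⟶ a⟦(1 : ℤ)⟧}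
    {f' : a' ⟶ b'} {g' : b' ⟶ c} {δ' : c ⟶ a'⟦(1 : ℤ)⟧}
    (h : Triangle.mk f g δ ∈ distTriang C) (h' : Triangle.mk f' g' δ' ∈ distTriang C)
    (hδ : NullOn t δ) (hδ' : NullOn t δ') (ha : ExtVanish t j a) (hb : ExtVanish t j b)
    (ha' : ExtVanish t j a') (hb' : ExtVanish t j b') :
    ind a + ind b' = ind a' + ind b := by
  obtain ⟨p, i, q, i', q', h1, h2⟩ := exists_pullback h h'
  have hp := ExtVanish.ext h1 ha hb'
  rw [← hind h1 (hδ.comp _) ha hp hb', ← hind h2 (hδ'.comp _) ha' hp hb]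

/-- Inductive step of the index: the range of additivity grows from vanishing up to degree j + 1 to
vanishing up to degree j, by resolving each object once. -/
lemma exists_index_step (hp : HasPrecovers t) {j : ℕ} (ht : ExtVanish t (j + 1) t)
    (hind : AdditiveOn t (ExtVanish t (j + 1)) ind) :
    ∃ ind' : C → G, (∀ c, addClosure t c → ind' c = ind c) ∧
      AdditiveOn t (ExtVanish t j) ind' := by
  choose K P f g δ hP hT hδ using hp.exists_triangle
  have hK : ∀ {c}, ExtVanish t j c → ExtVanish t (j + 1) (K c) := fun {c} hc =>
    ExtVanish.fiber (hT c) (hδ c) (.of_addClosure ht (hP c)) hc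
  have hP' : ∀ c, ExtVanish t (j + 1) (P c) := fun c => .of_addClosure ht (hP c)
  -- The new value at c can be computed from any F-exact triangle ending in c whose other terms lie
  -- in the smaller class, not only from the chosen precover.
  have key : ∀ {a b c : C} {f' : a ⟶ b} {g' : b ⟶ c} {δ' : c ⟶ a⟦(1 : ℤ)⟧},
      Triangle.mk f' g' δ' ∈ distTriang C → NullOn t δ' → ExtVanish t j c →
      ExtVanish t (j + 1) a → ExtVanish t (j + 1) b →
      ind (P c) - ind (K c) = ind b - ind a := by
    intro a b c f' g' δ' h hδ' hc ha hb
    have := hind.schanuel (hT c) h (hδ c) hδ' (hK hc) (hP' c) ha hb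
    rw [sub_eq_sub_iff_add_eq_add, add_comm, ← this, add_comm]
  refine ⟨fun c => ind (P c) - ind (K c), fun c hc => ?_, ?_⟩
  · have hc' : ExtVanish t (j + 1) c := .of_addClosure ht hc
    have := hind (hT c) (hδ c) (hK (hc'.mono (Nat.le_succ j))) (hP' c) hc'
    simp only [this, add_sub_cancel_left]
  · intro a b c f' g' δ' h hδ' ha hb hc
    have hg' := (nullOn_iff_epiOn h).1 hδ'
    -- The chosen precover of b, composed with b → c, is F-epi. Its fibre q computes the value at c,
    -- and the octahedron places q in a triangle K b → q → a, which Schanuel compares with the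
    -- precover of a.
    obtain ⟨q, i, ε, hq⟩ := exists_fiber (g b ≫ g')
    have hε : NullOn t ε := by
      rw [nullOn_iff_epiOn hq]
      intro u
      obtain ⟨v, rfl⟩ := hg' u
      obtain ⟨w, rfl⟩ := (nullOn_iff_epiOn (hT b)).1 (hδ b) v
      exact ⟨w, (Category.assoc _ _ _).symm⟩
    have hq' : ExtVanish t (j + 1) q := ExtVanish.fiber hq hε (hP' b) hc
    let o := someOctahedron' rfl (hT b) h hq
    have e1 := key hq hε hc hq' (hP' b)
    have e2 := hind.schanuel (hT a) o.mem (hδ a) ((hδ b).comp _) (hK ha) (hP' a) (hK hb) hq'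
    change ind (P b) - ind (K b) = (ind (P a) - ind (K a)) + (ind (P c) - ind (K c))
    rw [e1]
    have e3 : ind q = ind (K b) + ind (P a) - ind (K a) := by rw [← e2]; abel
    rw [e3]
    abel

/-- The index with respect to the additive closure of `t`, characterised by its additivity on
the triangles whose last morphism is killed by `Hom(t, -)`. -/
lemma exists_index (hp : HasPrecovers t) {N : ℕ}
    (hN : ∀ c, ExtVanish t N c ↔ addClosure t c) :
    ∃ ind : C → SplitK0 (addClosure t),
      (∀ c (hc : addClosure t c), ind c = SplitK0.cls c hc) ∧ AdditiveOn t (fun _ => True) ind := by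
  have ht : ExtVanish t N t := (hN t).2 (addClosure_self t)
  have main : ∀ m ≤ N, ∃ ind : C → SplitK0 (addClosure t),
      (∀ c (hc : addClosure t c), ind c = SplitK0.cls c hc) ∧
        AdditiveOn t (ExtVanish t (N - m)) ind := by
    intro m
    induction m with
    | zero =>
      intro _
      refine ⟨splitClass _, fun c hc => splitClass_eq hc, ?_⟩
      intro a b c f g δ h hδ ha hb hc
      exact splitClass_triangle h hδ ((hN a).1 ha) ((hN b).1 hb) ((hN c).1 hc)
    | succ m ih =>
      intro hm
      obtain ⟨ind, h1, h2⟩ := ih (by omega)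
      have hm' : N - m = N - (m + 1) + 1 := by omega
      rw [hm'] at h2
      obtain ⟨ind', h3, h4⟩ := exists_index_step hp (ht.mono (by omega)) h2
      exact ⟨ind', fun c hc => (h3 c hc).trans (h1 c hc), h4⟩
  -- At m = N the vanishing condition is empty, so additivity holds for all objects.
  obtain ⟨ind, h1, h2⟩ := main N le_rfl
  refine ⟨ind, h1, fun a b c f g δ h hδ _ _ _ => h2 h hδ ?_ ?_ ?_⟩ <;>
  · intro i h1 h2
    omega

end Index

/-! ### The defect of additivity of the index -/

section Defect

variable {C : Type u} [Category.{v} C] [Preadditive C] [HasZeroObject C] [HasShift C ℤ]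
  [∀ n : ℤ, (shiftFunctor C n).Additive] [Pretriangulated C] {t : C}
  {G : Type*} [AddCommGroup G] {ind : C → G}

lemma distinguished_of_iso {x y : C} (e : x ≅ y) :
    Triangle.mk e.hom (0 : y ⟶ 0) (0 : (0 : C) ⟶ x⟦(1 : ℤ)⟧) ∈ distTriang C :=
  isomorphic_distinguished _ (contractible_distinguished x) _
    (Triangle.isoMk _ _ (Iso.refl _) e.symm (Iso.refl _)
      (e.hom_inv_id.trans (Category.comp_id _).symm) (zero_comp.trans comp_zero.symm)
      (zero_comp.trans comp_zero.symm))

lemma AdditiveOn.map_zero (h : AdditiveOn t (fun _ => True) ind) : ind 0 = 0 :=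
  h.zero (isZero_zero C) trivial

lemma AdditiveOn.map_iso (h : AdditiveOn t (fun _ => True) ind) {x y : C} (e : x ≅ y) :
    ind x = ind y := by
  rw [h (distinguished_of_iso e) (fun u => comp_zero) trivial trivial trivial, h.map_zero,
    add_zero]

lemma nonempty_iso_of_fibers {a a' b c : C} {f : a ⟶ b} {f' : a' ⟶ b} {g : b ⟶ c}
    {δ : c ⟶ a⟦(1 : ℤ)⟧} {δ' : c ⟶ a'⟦(1 : ℤ)⟧}
    (h : Triangle.mk f g δ ∈ distTriang C) (h' : Triangle.mk f' g δ' ∈ distTriang C) :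
    Nonempty (a ≅ a') := by
  obtain ⟨k, h1, h2⟩ := complete_distinguished_triangle_morphism₁ _ _ h h' (𝟙 b) (𝟙 c)
    ((Category.comp_id _).trans (Category.id_comp _).symm)
  let φ : Triangle.mk f g δ ⟶ Triangle.mk f' g δ' :=
    { hom₁ := k
      hom₂ := 𝟙 b
      hom₃ := 𝟙 c
      comm₁ := h1
      comm₂ := (Category.comp_id _).trans (Category.id_comp _).symm
      comm₃ := h2 }
  have hφ : IsIso φ.hom₁ := isIso₁_of_isIso₂₃ φ h h' (inferInstanceAs (IsIso (𝟙 b)))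
    (inferInstanceAs (IsIso (𝟙 c)))
  exact ⟨@asIso _ _ _ _ φ.hom₁ hφ⟩

/-- For a triangle `Σ⁻¹ x ⟶ b ⟶ c ⟶ x`, the alternating sum of the values of `ind`. -/
def defect (ind : C → G) {c x : C} (g : c ⟶ x) : G :=
  ind (x⟦(-1 : ℤ)⟧) - ind (exists_fiber g).choose + ind c

lemma defect_eq (hind : AdditiveOn t (fun _ => True) ind) {a b c : C} {f : a ⟶ b} {g : b ⟶ c}
    {δ : c ⟶ a⟦(1 : ℤ)⟧} (h : Triangle.mk f g δ ∈ distTriang C) :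
    defect ind g = ind (c⟦(-1 : ℤ)⟧) - ind a + ind b := by
  obtain ⟨f', δ', h'⟩ := (exists_fiber g).choose_spec
  obtain ⟨e⟩ := nonempty_iso_of_fibers h h'
  rw [defect, hind.map_iso e]

/-- After rotation b is the fibre of δ, so the defect of the connecting morphism is exactly the
failure of additivity on the triangle. -/
lemma defect_mor₃ (hind : AdditiveOn t (fun _ => True) ind) {a b c : C} {f : a ⟶ b} {g : b ⟶ c}
    {δ : c ⟶ a⟦(1 : ℤ)⟧} (h : Triangle.mk f g δ ∈ distTriang C) :
    defect ind δ = ind a - ind b + ind c := by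
  rw [defect_eq hind (rotate_mk h)]
  congr 2
  exact hind.map_iso (shiftShiftNeg a (1 : ℤ))

lemma invRotate_mk {a b c : C} {f : a ⟶ b} {g : b ⟶ c} {δ : c ⟶ a⟦(1 : ℤ)⟧}
    (h : Triangle.mk f g δ ∈ distTriang C) :
    ∃ k, Triangle.mk k f (g ≫ (shiftEquiv C (1 : ℤ)).counitIso.inv.app c) ∈ distTriang C :=
  ⟨_, inv_rot_of_distTriang _ h⟩

/-- The contribution of an object to the defect. -/
def loopSum (ind : C → G) (m : C) : G := ind m + ind (m⟦(-1 : ℤ)⟧)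

lemma defect_id (hind : AdditiveOn t (fun _ => True) ind) (m : C) :
    defect ind (𝟙 m) = loopSum ind m := by
  have h : Triangle.mk (0 : (0 : C) ⟶ m) (𝟙 m) 0 ∈ distTriang C := contractible_distinguished₁ m
  rw [defect_eq hind h, hind.map_zero, sub_zero, loopSum, add_comm]

variable [IsTriangulated C]

/-- By the octahedral axiom the fibre k of p enters two F-exact triangles, k → c' → c and one
joining the fibres of p ≫ g and g. Its index then cancels. -/
lemma defect_epi_comp (hind : AdditiveOn t (fun _ => True) ind) {c' c x : C} (p : c' ⟶ c)
    (hp : EpiOn t p) (g : c ⟶ x) : defect ind (p ≫ g) = defect ind g := by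
  obtain ⟨k, i, ε, hk⟩ := exists_fiber p
  obtain ⟨b, f, δ, hb⟩ := exists_fiber g
  obtain ⟨q, f', δ', hq⟩ := exists_fiber (p ≫ g)
  let o := someOctahedron' rfl hk hb hq
  have hε := (nullOn_iff_epiOn hk).2 hp
  have e1 := hind hk hε trivial trivial trivial
  have e2 := hind o.mem (hε.comp _) trivial trivial trivial
  rw [defect_eq hind hb, defect_eq hind hq, e1, e2]
  abel

/-- Dual cancellation: the fibre b of g contributes to the fibre of p ≫ g and, by rotating b → x → y
back twice, equally to the index of Σ⁻¹ y. -/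
lemma defect_comp_mono (hind : AdditiveOn t (fun _ => True) ind) {c x y : C} (p : c ⟶ x)
    (g : x ⟶ y) (hg : MonoOn t g) : defect ind (p ≫ g) = defect ind p := by
  obtain ⟨k, i, ε, hk⟩ := exists_fiber p
  obtain ⟨b, f, δ, hb⟩ := exists_fiber g
  obtain ⟨q, f', δ', hq⟩ := exists_fiber (p ≫ g)
  let o := someOctahedron' rfl hk hb hq
  have hf := (nullOn_iff_monoOn hb).2 hg
  obtain ⟨k₁, h₁⟩ := invRotate_mk hb
  obtain ⟨k₂, h₂⟩ := invRotate_mk h₁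
  have e1 : ind (y⟦(-1 : ℤ)⟧) = ind (x⟦(-1 : ℤ)⟧) + ind b :=
    hind h₂ (hf.comp' _) trivial trivial trivial
  have e2 := hind o.mem (hf.comp' _) trivial trivial trivial
  rw [defect_eq hind hk, defect_eq hind hq, e1, e2]
  abel

lemma loopSum_eq (hind : AdditiveOn t (fun _ => True) ind) {m m' : C} (h : m ⟶ m')
    (hm : MonoOn t h) (he : EpiOn t h) : loopSum ind m = loopSum ind m' := by
  rw [← defect_id hind, ← defect_id hind, ← defect_epi_comp hind h he (𝟙 m'),
    ← defect_comp_mono hind (𝟙 m) h hm, Category.comp_id, Category.id_comp]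

/-- The defect of a morphism is the contribution of its image under `Hom(t, -)`. -/
lemma exists_image (hind : AdditiveOn t (fun _ => True) ind) (hp : HasPrecovers t)
    (ht : ExtVanish t 1 t) {c x : C} (g : c ⟶ x) :
    ∃ (m : C) (h : m ⟶ x), MonoOn t h ∧
      (∀ u : t ⟶ x, (∃ v, v ≫ g = u) ↔ ∃ v, v ≫ h = u) ∧ defect ind g = loopSum ind m := by
  obtain ⟨p₀, p, hp₀, hpe⟩ := hp c
  obtain ⟨k, i, ε, hk⟩ := exists_fiber (p ≫ g)
  obtain ⟨p₁, q, hp₁, hqe⟩ := hp k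
  -- Here p₁ → p₀ is a presentation of Im F g, so its cone m satisfies F m ≅ Im F g, as Hom(t, Σ p₁)
  -- = 0.
  obtain ⟨m, e, η, hm⟩ := distinguished_cocone_triangle (q ≫ i)
  obtain ⟨h, hh⟩ : ∃ h, p ≫ g = e ≫ h := Triangle.yoneda_exact₂ _ hm (p ≫ g) (by
    change (q ≫ i) ≫ p ≫ g = 0
    rw [Category.assoc, comp_zero₁₂ hk, comp_zero])
  have he : EpiOn t e := (nullOn_iff_epiOn hm).1 fun u =>
    ExtVanish.of_addClosure ht hp₁ 1 le_rfl le_rfl _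
  have hmono : MonoOn t h := by
    intro u hu
    obtain ⟨v, rfl⟩ := he u
    obtain ⟨w, rfl⟩ : ∃ w, v = w ≫ i := Triangle.coyoneda_exact₂ _ hk v (by
      change v ≫ p ≫ g = 0
      rw [hh, ← Category.assoc, hu])
    obtain ⟨s, rfl⟩ := hqe w
    have := comp_zero₁₂ hm
    rw [Category.assoc, Category.assoc, ← Category.assoc q, this, comp_zero]
  refine ⟨m, h, hmono, fun u => ⟨?_, ?_⟩, ?_⟩
  · rintro ⟨v, rfl⟩
    obtain ⟨w, rfl⟩ := hpe v
    exact ⟨w ≫ e, by rw [Category.assoc, ← hh, Category.assoc]⟩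
  · rintro ⟨v, rfl⟩
    obtain ⟨w, rfl⟩ := he v
    exact ⟨w ≫ p, by rw [Category.assoc, hh, Category.assoc]⟩
  · rw [← defect_epi_comp hind p hpe g, hh, defect_comp_mono hind e h hmono, ← defect_id hind,
      ← defect_epi_comp hind e he (𝟙 m), Category.comp_id]

end Defect

/-! ### Presentations of modules by objects of the additive closure -/

section Presentations

variable (k : Type w) [Field k] {C : Type u} [Category.{v} C] [Preadditive C] [Linear k C] {t : C}

/-- The right `End t`-module `Hom(t, c)`. -/
abbrev HomFrom (t c : C) : ModuleCat.{v} (End t)ᵐᵒᵖ := (preadditiveCoyonedaObj t).obj c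

/-- The morphism of modules `Hom(t, c) → Hom(t, x)` given by a morphism `c ⟶ x`. -/
def homMap (t : C) {c x : C} (g : c ⟶ x) : HomFrom t c →ₗ[(End t)ᵐᵒᵖ] HomFrom t x :=
  ((preadditiveCoyonedaObj t).map g).hom

lemma homMap_apply {c x : C} (g : c ⟶ x) (u : t ⟶ c) : homMap t g u = u ≫ g := rfl

lemma monoOn_of_injective {c x : C} {g : c ⟶ x} (h : Function.Injective (homMap t g)) :
    MonoOn t g := fun u hu => h (a₁ := u) (a₂ := (0 : t ⟶ c)) (hu.trans zero_comp.symm)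

lemma range_homMap_equiv_of_ker_eq {M : Type*} [AddCommGroup M] [Module (End t)ᵐᵒᵖ M] {c x : C}
    (γ : c ⟶ x) (φ : HomFrom t c →ₗ[(End t)ᵐᵒᵖ] M) (hφ : Function.Surjective φ)
    (h : ∀ u : t ⟶ c, u ≫ γ = 0 ↔ φ u = 0) :
    Nonempty (LinearMap.range (homMap t γ) ≃ₗ[(End t)ᵐᵒᵖ] M) := by
  have hker : LinearMap.ker (homMap t γ) = LinearMap.ker φ := by
    ext u
    exact h u
  exact ⟨(homMap t γ).quotKerEquivRange.symm.trans
    ((Submodule.quotEquivOfEq _ _ hker).trans (φ.quotKerEquivOfSurjective hφ))⟩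

variable [HasFiniteBiproducts C]

/-- The morphism out of `Hom(t, tⁿ)` determined by the images of the inclusions. -/
def homDesc (t : C) {M : Type*} [AddCommGroup M] [Module (End t)ᵐᵒᵖ M] {n : ℕ} (m : Fin n → M) :
    HomFrom t (⨁ fun _ : Fin n => t) →ₗ[(End t)ᵐᵒᵖ] M where
  toFun u := ∑ i, MulOpposite.op (show End t from
    (show t ⟶ ⨁ fun _ : Fin n => t from u) ≫ biproduct.π (fun _ : Fin n => t) i) • m i
  map_add' u u' := by
    rw [← Finset.sum_add_distrib]
    refine Finset.sum_congr rfl fun i _ => ?_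
    rw [← add_smul]
    congr 1
    rw [← MulOpposite.op_add]
    congr 1
    exact Preadditive.add_comp _ _ _ _ _ _
  map_smul' r u := by
    rw [Finset.smul_sum]
    refine Finset.sum_congr rfl fun i _ => ?_
    rw [RingHom.id_apply, smul_smul]
    congr 1
    apply MulOpposite.unop_injective
    exact Category.assoc _ _ _

lemma homDesc_ι {M : Type*} [AddCommGroup M] [Module (End t)ᵐᵒᵖ M] {n : ℕ} (m : Fin n → M)
    (i : Fin n) :
    homDesc t m (biproduct.ι (fun _ : Fin n => t) i : t ⟶ _) = m i := by
  change ∑ j, MulOpposite.op (show End t from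
    biproduct.ι (fun _ : Fin n => t) i ≫ biproduct.π (fun _ : Fin n => t) j) • m j = m i
  rw [Finset.sum_eq_single i]
  · rw [biproduct.ι_π_self]
    exact one_smul _ _
  · intro j _ hj
    rw [biproduct.ι_π_ne _ (Ne.symm hj)]
    exact zero_smul _ _
  · simp

lemma hom_biproduct_ext {M : Type*} [AddCommGroup M] [Module (End t)ᵐᵒᵖ M] {n : ℕ}
    {φ ψ : HomFrom t (⨁ fun _ : Fin n => t) →ₗ[(End t)ᵐᵒᵖ] M}
    (h : ∀ i, φ (biproduct.ι (fun _ : Fin n => t) i : t ⟶ _) =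
      ψ (biproduct.ι (fun _ : Fin n => t) i : t ⟶ _)) : φ = ψ := by
  ext u
  have total : ∀ v : t ⟶ ⨁ fun _ : Fin n => t, v = ∑ i,
      (v ≫ biproduct.π (fun _ : Fin n => t) i) ≫ biproduct.ι (fun _ : Fin n => t) i := by
    intro v
    simp only [Category.assoc]
    rw [← Preadditive.comp_sum, biproduct.total, Category.comp_id]
  have hu : u = ∑ i, MulOpposite.op (show End t from
      (show t ⟶ ⨁ fun _ : Fin n => t from u) ≫ biproduct.π (fun _ : Fin n => t) i) •
      (show HomFrom t (⨁ fun _ : Fin n => t) from biproduct.ι (fun _ : Fin n => t) i) := total u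
  rw [hu, map_sum, map_sum]
  refine Finset.sum_congr rfl fun i _ => ?_
  rw [map_smul, map_smul]
  congr 1
  exact h i

lemma exists_hom_of_linearMap {n : ℕ} {c : C}
    (φ : HomFrom t (⨁ fun _ : Fin n => t) →ₗ[(End t)ᵐᵒᵖ] HomFrom t c) :
    ∃ g : (⨁ fun _ : Fin n => t) ⟶ c, φ = homMap t g := by
  refine ⟨biproduct.desc fun i =>
    (show t ⟶ c from φ (biproduct.ι (fun _ : Fin n => t) i : t ⟶ _)), ?_⟩
  apply hom_biproduct_ext
  intro i
  rw [homMap_apply, biproduct.ι_desc]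

/-- A projective presentation of a finitely generated module. -/
lemma exists_presentation [∀ X Y : C, Module.Finite k (X ⟶ Y)] (M : Type*) [AddCommGroup M]
    [Module (End t)ᵐᵒᵖ M] [Module.Finite (End t)ᵐᵒᵖ M] :
    ∃ (n m : ℕ) (f : (⨁ fun _ : Fin m => t) ⟶ ⨁ fun _ : Fin n => t)
      (φ : HomFrom t (⨁ fun _ : Fin n => t) →ₗ[(End t)ᵐᵒᵖ] M), Function.Surjective φ ∧
      ∀ u : t ⟶ ⨁ fun _ : Fin n => t, φ u = 0 ↔ ∃ v, v ≫ f = u := by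
  obtain ⟨n, s, hs⟩ := Module.Finite.exists_fin (R := (End t)ᵐᵒᵖ) (M := M)
  let P := ⨁ fun _ : Fin n => t
  have hφ : Function.Surjective (homDesc t s) := by
    rw [← LinearMap.range_eq_top, eq_top_iff, ← hs, Submodule.span_le]
    rintro _ ⟨i, rfl⟩
    exact ⟨_, homDesc_ι s i⟩
  -- The kernel is finite dimensional over k, so a finite k-spanning family already generates it
  -- over End t. No Noetherian argument is needed.
  let K : Submodule k (t ⟶ P) :=
    { carrier := {u | homDesc t s u = 0}
      add_mem' := fun {u v} hu hv => (map_add (homDesc t s) _ _).trans (by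
        rw [show homDesc t s u = 0 from hu, show homDesc t s v = 0 from hv, add_zero])
      zero_mem' := map_zero (homDesc t s)
      smul_mem' := fun a u hu => by
        have h : (a • u : t ⟶ P) = (a • 𝟙 t) ≫ u := by simp
        change homDesc t s (a • u : t ⟶ P) = 0
        rw [h]
        refine ((homDesc t s).map_smul (MulOpposite.op (show End t from a • 𝟙 t)) u).trans ?_
        exact (congrArg (_ • ·) hu).trans (smul_zero _) }
  obtain ⟨m, g, hg⟩ := Module.Finite.exists_fin (R := k) (M := K)
  let f : (⨁ fun _ : Fin m => t) ⟶ P := biproduct.desc fun i => (g i : t ⟶ P)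
  refine ⟨n, m, f, homDesc t s, hφ, fun u => ⟨fun hu => ?_, ?_⟩⟩
  · have hK : (⟨u, hu⟩ : K) ∈ Submodule.span k (Set.range g) := by rw [hg]; trivial
    obtain ⟨a, ha⟩ := (Submodule.mem_span_range_iff_exists_fun k).1 hK
    refine ⟨∑ i, a i • biproduct.ι (fun _ : Fin m => t) i, ?_⟩
    have ha' := congrArg Subtype.val ha
    rw [← show _ = u from ha', Preadditive.sum_comp]
    simp [f]
  · rintro ⟨v, rfl⟩
    have : (homDesc t s).comp (homMap t f) = 0 := by
      apply hom_biproduct_ext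
      intro i
      exact (congrArg (homDesc t s) (biproduct.ι_desc _ _)).trans (g i).2
    exact LinearMap.congr_fun this v

end Presentations

/-! ### The homomorphism on the Grothendieck group of modules -/

section ModuleGrothendieck

lemma K0.cls_of_exact {R : Type w} [Ring R] {K L M : FGModuleCat.{v} R} (f : K.obj →ₗ[R] L.obj)
    (g : L.obj →ₗ[R] M.obj) (hf : Function.Injective f) (hfg : Function.Exact f g)
    (hg : Function.Surjective g) : K0.cls L = K0.cls K + K0.cls M := by
  have : (QuotientAddGroup.mk (FreeAbelianGroup.of L - FreeAbelianGroup.of K -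
      FreeAbelianGroup.of M) : K0.{v} R) = 0 := by
    rw [QuotientAddGroup.eq_zero_iff]
    exact AddSubgroup.subset_closure ⟨K, L, M, f, g, hf, hfg, hg, rfl⟩
  rw [QuotientAddGroup.mk_sub, QuotientAddGroup.mk_sub, sub_sub, sub_eq_zero] at this
  exact this

lemma K0.cls_eq_zero {R : Type w} [Ring R] {M : FGModuleCat.{v} R} (h : Subsingleton M.obj) :
    K0.cls M = 0 := by
  have := K0.cls_of_exact (K := M) (L := M) (M := M) LinearMap.id LinearMap.id
    (fun _ _ h => h) (fun _ => ⟨fun _ => ⟨0, Subsingleton.elim _ _⟩, fun _ => Subsingleton.elim _ _⟩)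
    (fun x => ⟨x, rfl⟩)
  simpa using this

lemma K0.cls_of_linearEquiv {R : Type w} [Ring R] {M N : FGModuleCat.{v} R}
    (e : M.obj ≃ₗ[R] N.obj) : K0.cls M = K0.cls N := by
  let Z : FGModuleCat.{v} R := FGModuleCat.of R PUnit.{v + 1}
  have hZ : Subsingleton Z.obj := inferInstanceAs (Subsingleton PUnit)
  have := K0.cls_of_exact (K := M) (L := N) (M := Z) e.toLinearMap 0 e.injective
    (fun y => ⟨fun _ => e.surjective y, fun _ => rfl⟩) (fun y => ⟨0, Subsingleton.elim _ _⟩)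
  rw [this, K0.cls_eq_zero hZ, add_zero]

lemma K0.hom_ext {R : Type w} [Ring R] {G : Type*} [AddCommGroup G] {θ θ' : K0.{v} R →+ G}
    (h : ∀ M : FGModuleCat.{v} R, θ (K0.cls M) = θ' (K0.cls M)) : θ = θ' :=
  QuotientAddGroup.addMonoidHom_ext _ (FreeAbelianGroup.lift_ext _ _ h)

lemma K0.exists_hom {R : Type w} [Ring R] {G : Type*} [AddCommGroup G] (θ : FGModuleCat.{v} R → G)
    (h : ∀ (K L M : FGModuleCat.{v} R) (f : K.obj →ₗ[R] L.obj) (g : L.obj →ₗ[R] M.obj),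
      Function.Injective f → Function.Exact f g → Function.Surjective g → θ L = θ K + θ M) :
    ∃ Θ : K0.{v} R →+ G, ∀ M, Θ (K0.cls M) = θ M := by
  refine ⟨QuotientAddGroup.lift _ (FreeAbelianGroup.lift θ) ?_, fun M => ?_⟩
  · rw [k0Relations, AddSubgroup.closure_le]
    rintro _ ⟨K, L, M, f, g, hf, hfg, hg, rfl⟩
    simp [h K L M f g hf hfg hg]
  · exact FreeAbelianGroup.lift_apply_of _ _

end ModuleGrothendieck

section ImageModule

variable {C : Type u} [Category.{v} C] [Preadditive C] {t : C}

lemma cls_imageF_of_ker_eq (k : Type w) [Field k] [Linear k C]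
    [∀ X Y : C, Module.Finite k (X ⟶ Y)] {c x y : C} (γ : c ⟶ x) (γ' : c ⟶ y)
    (h : ∀ u : t ⟶ c, u ≫ γ = 0 ↔ u ≫ γ' = 0) :
    K0.cls (imageF k t γ) = K0.cls (imageF k t γ') := by
  obtain ⟨ε⟩ := range_homMap_equiv_of_ker_eq γ (homMap t γ').rangeRestrict
    (homMap t γ').surjective_rangeRestrict fun u => by
      rw [h]
      exact (Subtype.ext_iff (a1 := (homMap t γ').rangeRestrict u) (a2 := 0)).symm
  exact K0.cls_of_linearEquiv ε

end ImageModule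

/-! ### Representing modules by objects, and the construction of θ -/

section Theta

variable {C : Type u} [Category.{v} C] [Preadditive C]
  [HasZeroObject C] [HasShift C ℤ] [∀ n : ℤ, (shiftFunctor C n).Additive] [Pretriangulated C]
  {t : C}

/-- Every finitely generated module is of the form `Hom(t, l)`, and `l` can be chosen in such a
way that morphisms out of `Hom(t, l)` lift. -/
lemma exists_representative (k : Type w) [Field k] [Linear k C]
    [∀ X Y : C, Module.Finite k (X ⟶ Y)]
    (ht : ExtVanish t 1 t) (M : Type*) [AddCommGroup M]
    [Module (End t)ᵐᵒᵖ M] [Module.Finite (End t)ᵐᵒᵖ M] :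
    ∃ (l : C) (_ : HomFrom t l ≃ₗ[(End t)ᵐᵒᵖ] M),
      ∀ (c : C) (ψ : HomFrom t l →ₗ[(End t)ᵐᵒᵖ] HomFrom t c), ∃ g : l ⟶ c, ψ = homMap t g := by
  obtain ⟨n, m, f, φ, hφ, hf⟩ := exists_presentation k (t := t) M
  -- Since Hom(t, Σ tᵐ) = 0, F sends the cone of the presentation to its cokernel. A linear map out
  -- of F l lifts on tⁿ by projectivity and then factors through the cone.
  obtain ⟨l, e, η, hl⟩ := distinguished_cocone_triangle f
  have he : EpiOn t e := (nullOn_iff_epiOn hl).1 fun u =>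
    ExtVanish.of_addClosure ht (addClosure_biproduct t m) 1 le_rfl le_rfl _
  have hsurj : Function.Surjective (homMap t e) := he
  have hker : ∀ u : t ⟶ ⨁ fun _ : Fin n => t, homMap t e u = 0 ↔ φ u = 0 := by
    intro u
    rw [hf]
    constructor
    · intro hu
      obtain ⟨v, hv⟩ := Triangle.coyoneda_exact₂ _ hl u hu
      exact ⟨v, hv.symm⟩
    · rintro ⟨v, rfl⟩
      rw [homMap_apply, Category.assoc, comp_zero₁₂ hl, comp_zero]
      rfl
  have hker' : LinearMap.ker (homMap t e) = LinearMap.ker φ := by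
    ext u
    exact hker u
  refine ⟨l, ((homMap t e).quotKerEquivOfSurjective hsurj).symm.trans
    ((Submodule.quotEquivOfEq _ _ hker').trans (φ.quotKerEquivOfSurjective hφ)),
    fun c ψ => ?_⟩
  obtain ⟨g, hg⟩ := exists_hom_of_linearMap (ψ.comp (homMap t e))
  have hfg : f ≫ g = 0 := by
    refine NullOn.eq_zero (t := t) (fun u => ?_) (addClosure_biproduct t m)
    have h1 : (homMap t e) (u ≫ f) = 0 := (hker _).2 ((hf _).2 ⟨u, rfl⟩)
    have h2 : (homMap t g) (u ≫ f) = 0 := by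
      rw [← hg]
      exact (congrArg ψ h1).trans (map_zero ψ)
    rw [← Category.assoc]
    exact h2
  obtain ⟨h, hh⟩ : ∃ h : l ⟶ c, g = e ≫ h := Triangle.yoneda_exact₂ _ hl g hfg
  refine ⟨h, ?_⟩
  ext x
  obtain ⟨u, rfl⟩ := hsurj x
  have h3 := LinearMap.congr_fun hg u
  have h4 : ∀ u : t ⟶ ⨁ fun _ : Fin n => t, u ≫ g = (u ≫ e) ≫ h := fun u => by
    rw [Category.assoc, hh]
  exact h3.trans (h4 u)

variable [IsTriangulated C] {G : Type*} [AddCommGroup G] {ind : C → G}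

/-- The isomorphism need not come from a morphism c ⟶ c'. Both objects are instead compared with a
representative l, whose isomorphisms to F c and F c' do lift. -/
lemma loopSum_of_linearEquiv (k : Type w) [Field k] [Linear k C]
    [∀ X Y : C, Module.Finite k (X ⟶ Y)]
    (hind : AdditiveOn t (fun _ => True) ind) (ht : ExtVanish t 1 t)
    {c c' : C} (e : HomFrom t c ≃ₗ[(End t)ᵐᵒᵖ] HomFrom t c') : loopSum ind c = loopSum ind c' := by
  have := finite_hom k t c
  obtain ⟨l, e', hl⟩ := exists_representative k ht (HomFrom t c)
  have key : ∀ {x : C} (ε : HomFrom t l ≃ₗ[(End t)ᵐᵒᵖ] HomFrom t x),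
      loopSum ind l = loopSum ind x := by
    intro x ε
    obtain ⟨g, hg⟩ := hl x ε.toLinearMap
    refine loopSum_eq hind g (monoOn_of_injective ?_) ?_
    · rw [← hg]
      exact ε.injective
    · have : Function.Surjective (homMap t g) := by
        rw [← hg]
        exact ε.surjective
      exact this
  rw [← key e', key (e'.trans e)]

/-- The homomorphism `θ`, measuring the failure of the index to be additive on triangles. -/
lemma exists_theta (k : Type w) [Field k] [Linear k C]
    [∀ X Y : C, Module.Finite k (X ⟶ Y)]
    (hind : AdditiveOn t (fun _ => True) ind) (hp : HasPrecovers t)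
    (ht : ExtVanish t 1 t) :
    ∃ θ : K0.{v} (End t)ᵐᵒᵖ →+ G, ∀ {c x : C} (g : c ⟶ x),
      θ (K0.cls (imageF k t g)) = defect ind g := by
  have hrep : ∀ M : FGModuleCat.{v} (End t)ᵐᵒᵖ, ∃ (l : C) (_ : HomFrom t l ≃ₗ[(End t)ᵐᵒᵖ] M.obj),
      ∀ (c : C) (ψ : HomFrom t l →ₗ[(End t)ᵐᵒᵖ] HomFrom t c), ∃ g : l ⟶ c, ψ = homMap t g :=
    fun M => exists_representative k ht M
  choose l e hl using hrep
  have image : ∀ {c x : C} (g : c ⟶ x) (M : FGModuleCat.{v} (End t)ᵐᵒᵖ)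
      (_ : M.obj ≃ₗ[(End t)ᵐᵒᵖ] LinearMap.range (homMap t g)),
      loopSum ind (l M) = defect ind g := by
    intro c x g M ε
    obtain ⟨m, h, h1, h2, h3⟩ := exists_image hind hp ht g
    have hinj : Function.Injective (homMap t h) := by
      rw [← LinearMap.ker_eq_bot, LinearMap.ker_eq_bot']
      exact h1
    have hrange : LinearMap.range (homMap t g) = LinearMap.range (homMap t h) := by
      ext u
      exact h2 u
    rw [h3]
    exact loopSum_of_linearEquiv k hind ht ((e M).trans (ε.trans ((LinearEquiv.ofEq _ _ hrange).trans
      (LinearEquiv.ofInjective _ hinj).symm)))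
  obtain ⟨θ, hθ⟩ := K0.exists_hom (R := (End t)ᵐᵒᵖ) (fun M => loopSum ind (l M)) (by
    intro K L M f g hf hfg hg
    obtain ⟨q, hq⟩ := hl L (l M) ((e M).symm.toLinearMap.comp (g.comp (e L).toLinearMap))
    have hqepi : EpiOn t q := by
      have : Function.Surjective (homMap t q) := by
        rw [← hq]
        exact (e M).symm.surjective.comp (hg.comp (e L).surjective)
      exact this
    -- F i has image ker F q ≅ K. So the value at K is the defect of i, computed from the rotated
    -- triangle, and F-exactness of a → l L → l M supplies the other relation.
    obtain ⟨a, i, δ, h⟩ := exists_fiber q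
    have hrange : ∀ u, u ∈ LinearMap.range (homMap t i) ↔ e L u ∈ LinearMap.range f := by
      intro u
      have h1 : e L u ∈ LinearMap.range f ↔ homMap t q u = 0 := by
        rw [← hq]
        change _ ↔ (e M).symm (g (e L u)) = 0
        rw [LinearEquiv.map_eq_zero_iff]
        exact (hfg (e L u)).symm
      rw [h1]
      constructor
      · rintro ⟨v, rfl⟩
        change ((show t ⟶ _ from v) ≫ i) ≫ q = 0
        rw [Category.assoc, comp_zero₁₂ h, comp_zero]
      · intro hu
        obtain ⟨v, hv⟩ := Triangle.coyoneda_exact₂ _ h u hu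
        exact ⟨v, hv.symm⟩
    have hmap : (LinearMap.range (homMap t i)).map (e L).toLinearMap = LinearMap.range f := by
      ext y
      constructor
      · rintro ⟨u, hu, rfl⟩
        exact (hrange u).1 hu
      · intro hy
        exact ⟨(e L).symm y, (hrange _).2 (by rwa [LinearEquiv.apply_symm_apply]),
          (e L).apply_symm_apply y⟩
    have eK : K.obj ≃ₗ[(End t)ᵐᵒᵖ] LinearMap.range (homMap t i) :=
      (LinearEquiv.ofInjective f hf).trans
        ((LinearEquiv.ofEq _ _ hmap.symm).trans ((e L).submoduleMap _).symm)
    have e1 := hind h ((nullOn_iff_epiOn h).2 hqepi) trivial trivial trivial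
    obtain ⟨k₁, hk₁⟩ := invRotate_mk h
    have e2 : defect ind i = ind ((l L)⟦(-1 : ℤ)⟧) - ind ((l M)⟦(-1 : ℤ)⟧) + ind a :=
      defect_eq hind hk₁
    change loopSum ind (l L) = loopSum ind (l K) + loopSum ind (l M)
    rw [image i K eK, e2, loopSum, loopSum, e1]
    abel)
  refine ⟨θ, fun {c x} g => ?_⟩
  rw [hθ]
  exact image g _ (LinearEquiv.refl _ _)

end Theta

/-! ### Minimal approximations -/

section Fitting

open Polynomial

/-- Fitting's lemma for an element of a finite dimensional algebra: an idempotent on which the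
element is invertible and whose complement kills a power of the element. -/
lemma exists_fitting_idempotent (k : Type*) [Field k] {A : Type*} [Ring A] [Algebra k A]
    [Module.Finite k A] (x : A) :
    ∃ (e y : A) (n : ℕ), e * e = e ∧ e = x * y ∧ e = y * x ∧ x ^ n * (1 - e) = 0 := by
  obtain ⟨p, hp0, hp⟩ : ∃ p : k[X], p ≠ 0 ∧ aeval x p = 0 :=
    ⟨minpoly k x, minpoly.ne_zero (Algebra.IsIntegral.isIntegral x), minpoly.aeval k x⟩
  obtain ⟨q, hq, hdvd⟩ := exists_eq_pow_rootMultiplicity_mul_and_not_dvd p hp0 0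
  set n := p.rootMultiplicity 0
  rw [map_zero, sub_zero] at hq hdvd
  -- The exponent n + 1 rather than n guarantees that the idempotent a * X ^ (n + 1) is divisible by
  -- X even when X does not divide p.
  have hcop : IsCoprime (X ^ (n + 1)) q := by
    refine IsCoprime.pow_left ?_
    exact (irreducible_X.coprime_iff_not_dvd).2 hdvd
  obtain ⟨a, b, hab⟩ := hcop
  have h0 : aeval x (X ^ (n + 1) * q) = 0 := by
    rw [pow_succ', mul_assoc, ← hq, map_mul, hp, mul_zero]
  have hsub : (1 : k[X]) - a * X ^ (n + 1) = b * q := by rw [← hab]; ring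
  have e1 : (1 : A) - aeval x (a * X ^ (n + 1)) = aeval x (b * q) := by
    rw [← hsub, map_sub, map_one]
  refine ⟨aeval x (a * X ^ (n + 1)), aeval x (a * X ^ n), n + 1, ?_, ?_, ?_, ?_⟩
  · have : aeval x (a * X ^ (n + 1)) * (1 - aeval x (a * X ^ (n + 1))) = 0 := by
      rw [e1, ← map_mul, show a * X ^ (n + 1) * (b * q) = a * b * (X ^ (n + 1) * q) by ring,
        map_mul, h0, mul_zero]
    rw [mul_sub, mul_one, sub_eq_zero] at this
    exact this.symm
  · rw [show a * X ^ (n + 1) = X * (a * X ^ n) by ring, map_mul, aeval_X]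
  · rw [show a * X ^ (n + 1) = a * X ^ n * X by ring, map_mul, aeval_X]
  · have hX : aeval x (X ^ (n + 1) : k[X]) = x ^ (n + 1) := by rw [map_pow, aeval_X]
    rw [e1, ← hX, ← map_mul, show X ^ (n + 1) * (b * q) = b * (X ^ (n + 1) * q) by ring,
      map_mul, h0, mul_zero]

end Fitting

/-! ### Right minimal morphisms and right minimal precovers -/

section Minimal

variable {C : Type u} [Category.{v} C]

/-- The morphism `f` is right minimal. -/
def RightMinimal {x y : C} (f : x ⟶ y) : Prop := ∀ φ : x ⟶ x, φ ≫ f = f → IsIso φ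

lemma RightMinimal.isIso {x y : C} {f : x ⟶ y} (hf : RightMinimal f) {s : y ⟶ x}
    (h : s ≫ f = 𝟙 y) : IsIso f := by
  have := hf (f ≫ s) (by rw [Category.assoc, h, Category.comp_id])
  have : Mono (f ≫ s) := inferInstance
  have hm : Mono f := mono_of_mono f s
  refine ⟨s, ?_, h⟩
  rw [← cancel_mono f, Category.assoc, h, Category.comp_id, Category.id_comp]

variable [Preadditive C] {t : C}

/-- The inverse is 1 + f (1 - gf)⁻¹ g, as for the Jacobson radical of a ring. -/
lemma isIso_one_sub_comp {x y : C} {f : x ⟶ y} {g : y ⟶ x} (h : IsIso (𝟙 y - g ≫ f)) :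
    IsIso (𝟙 x - f ≫ g) := by
  set i := inv (𝟙 y - g ≫ f)
  have h1 : i - i ≫ g ≫ f = 𝟙 y := by
    have := IsIso.inv_hom_id (𝟙 y - g ≫ f)
    rwa [Preadditive.comp_sub, Category.comp_id] at this
  have h2 : i - g ≫ f ≫ i = 𝟙 y := by
    have := IsIso.hom_inv_id (𝟙 y - g ≫ f)
    rwa [Preadditive.sub_comp, Category.id_comp, Category.assoc] at this
  refine ⟨𝟙 x + f ≫ i ≫ g, ?_, ?_⟩
  · have h3 : f ≫ (i - g ≫ f ≫ i) ≫ g = f ≫ g := by rw [h2, Category.id_comp]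
    simp only [Preadditive.comp_sub, Preadditive.sub_comp, Preadditive.comp_add,
      Category.id_comp, Category.comp_id, Category.assoc] at h3 ⊢
    rw [← sub_eq_zero] at h3 ⊢
    rw [← h3]
    abel
  · have h3 : f ≫ (i - i ≫ g ≫ f) ≫ g = f ≫ g := by rw [h1, Category.id_comp]
    simp only [Preadditive.comp_sub, Preadditive.sub_comp, Preadditive.add_comp,
      Category.id_comp, Category.comp_id, Category.assoc] at h3 ⊢
    rw [← sub_eq_zero] at h3 ⊢
    rw [← h3]
    abel

/-- A morphism killed by a right minimal morphism is in the radical. -/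
lemma RightMinimal.inRadical {x y z : C} {f : y ⟶ z} (hf : RightMinimal f) {g : x ⟶ y}
    (h : g ≫ f = 0) : InRadical g := by
  intro u
  apply isIso_one_sub_comp
  apply hf
  rw [Preadditive.sub_comp, Category.id_comp, Category.assoc, h, comp_zero, sub_zero]

variable [HasFiniteBiproducts C]

/-- Right minimal precovers exist. -/
lemma exists_minimal_precover [IsIdempotentComplete C] (k : Type w) [Field k] [Linear k C]
    [∀ X Y : C, Module.Finite k (X ⟶ Y)] {c : C}
    (hc : ∃ (p : C) (f : p ⟶ c), addClosure t p ∧ EpiOn t f) :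
    ∃ (p : C) (f : p ⟶ c), addClosure t p ∧ EpiOn t f ∧ RightMinimal f := by
  classical
  have hex : ∃ n, ∃ (p : C) (f : p ⟶ c), addClosure t p ∧ EpiOn t f ∧
      Module.finrank k (t ⟶ p) = n := by
    obtain ⟨p, f, h1, h2⟩ := hc
    exact ⟨_, p, f, h1, h2, rfl⟩
  -- A precover minimising dim Hom(t, p) is right minimal: the Fitting idempotent e of φ fixes f, so
  -- its image is again a precover. Minimality forces e = 1, and then φ is invertible.
  obtain ⟨p, f, hp, hf, hn⟩ := Nat.find_spec hex
  refine ⟨p, f, hp, hf, fun φ hφ => ?_⟩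
  have : Module.Finite k (End p) := inferInstanceAs (Module.Finite k (p ⟶ p))
  let Φ : End p := φ
  obtain ⟨e, y, n, hee, hxy, hyx, hpow⟩ := exists_fitting_idempotent k Φ
  have hee' : (show p ⟶ p from e) ≫ (show p ⟶ p from e) = e := hee
  obtain ⟨q, i, r, hir, hri⟩ := IsIdempotentComplete.idempotents_split p e hee'
  have hef : (show p ⟶ p from e) ≫ f = f := by
    have h1 : ∀ m : ℕ, (End.asHom (Φ ^ m)) ≫ f = f := by
      intro m
      induction m with
      | zero => exact Category.id_comp f
      | succ m ih =>
        have : (End.asHom (Φ ^ (m + 1))) =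
            φ ≫ (End.asHom (Φ ^ m)) := pow_succ Φ m
        rw [this, Category.assoc, ih, hφ]
    -- Multiplication in `End p` is composition in the reverse order, so x ^ n * (1 - e) applies 1 -
    -- e first.
    have h2 : (𝟙 p - (show p ⟶ p from e)) ≫ (End.asHom (Φ ^ n)) = 0 := hpow
    have h3 : (𝟙 p - (show p ⟶ p from e)) ≫ f = 0 := by
      rw [← h1 n, ← Category.assoc, h2, zero_comp]
    rw [Preadditive.sub_comp, Category.id_comp, sub_eq_zero] at h3
    exact h3.symm
  have hq : addClosure t q := addClosure_of_retract ⟨i, r, hir⟩ hp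
  have hif : EpiOn t (i ≫ f) := by
    intro u
    obtain ⟨v, rfl⟩ := hf u
    refine ⟨v ≫ r, ?_⟩
    rw [Category.assoc, ← Category.assoc r, hri, hef]
  have hle : Module.finrank k (t ⟶ p) ≤ Module.finrank k (t ⟶ q) := by
    rw [hn]
    exact Nat.find_min' hex ⟨q, i ≫ f, hq, hif, rfl⟩
  let I : (t ⟶ q) →ₗ[k] (t ⟶ p) := Linear.rightComp k t i
  have hI : Function.Injective I := by
    intro u v huv
    have : (u ≫ i) ≫ r = (v ≫ i) ≫ r := congrArg (· ≫ r) huv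
    simpa [hir] using this
  have hsurj : Function.Surjective I :=
    (LinearMap.injective_iff_surjective_of_finrank_eq_finrank
      (le_antisymm (LinearMap.finrank_le_finrank_of_injective hI) hle)).1 hI
  have he : 𝟙 p - (show p ⟶ p from e) = 0 := by
    refine NullOn.eq_zero (t := t) (fun u => ?_) hp
    obtain ⟨v, rfl⟩ := hsurj u
    change (v ≫ i) ≫ _ = 0
    rw [← hri, Preadditive.comp_sub, Category.comp_id, Category.assoc, ← Category.assoc i, hir,
      Category.id_comp, sub_self]
  rw [sub_eq_zero] at he
  refine ⟨y, ?_, ?_⟩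
  · exact (show φ ≫ (show p ⟶ p from y) = e from hyx.symm).trans he.symm
  · exact (show (show p ⟶ p from y) ≫ φ = e from hxy.symm).trans he.symm

end Minimal

/-! ### Towers of triangles -/

section ComposeShifted

variable {C : Type u} [Category.{v} C] [Preadditive C] [HasShift C ℤ] {t : C} {d : ℕ}

lemma comp_shift_zero_eq_zero_iff {x y : C} (δ : x ⟶ y⟦(1 : ℤ)⟧) (u : t ⟶ x)
    (h : (1 : ℤ) + 0 = 1) :
    u ≫ (shiftFunctorZero C ℤ).inv.app x ≫ δ⟦(0 : ℤ)⟧' ≫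
      (shiftFunctorAdd' C (1 : ℤ) 0 1 h).inv.app y = 0 ↔ u ≫ δ = 0 := by
  have nat : δ ≫ (shiftFunctorZero C ℤ).inv.app _ =
      (shiftFunctorZero C ℤ).inv.app x ≫ δ⟦(0 : ℤ)⟧' :=
    (shiftFunctorZero C ℤ).inv.naturality δ
  rw [← Category.assoc ((shiftFunctorZero C ℤ).inv.app x), ← nat]
  simp only [← Category.assoc]
  constructor
  · intro h
    have h1 := monoOn_of_mono (t := t) ((shiftFunctorAdd' C (1 : ℤ) 0 1 (by assumption)).inv.app y) _ h
    exact monoOn_of_mono (t := t) ((shiftFunctorZero C ℤ).inv.app _) _ h1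
  · intro h
    rw [h, zero_comp, zero_comp]

/-- All factors after the first are injective on Hom(t, -), so only δ_0 decides the kernel of the
composite. -/
lemma comp_composeShifted_eq_zero_iff (hd : 1 ≤ d) {w : Fin (d + 1) → C}
    {δ : (i : Fin d) → (w i.castSucc ⟶ (w i.succ)⟦(1 : ℤ)⟧)}
    (hδ : ∀ (i : Fin d), 1 ≤ (i : ℕ) → MonoOn t ((δ i)⟦((i : ℕ) : ℤ)⟧')) {j : ℕ} (hj : j + 1 < d + 1)
    (u : t ⟶ w 0) : u ≫ composeShifted w δ (j + 1) hj = 0 ↔ u ≫ δ ⟨0, hd⟩ = 0 := by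
  induction j with
  | zero =>
    exact comp_shift_zero_eq_zero_iff (δ ⟨0, hd⟩) u _
  | succ j ih =>
    rw [← ih (Nat.lt_of_succ_lt hj), composeShifted]
    constructor
    · intro h
      have hmono : MonoOn t ((δ ⟨j + 1, Nat.lt_of_succ_lt_succ hj⟩)⟦((j + 1 : ℕ) : ℤ)⟧' ≫
          (shiftFunctorAdd' C (1 : ℤ) ((j + 1 : ℕ) : ℤ) ((j + 1 + 1 : ℕ) : ℤ)
            (by push_cast; ring)).inv.app _) :=
        (hδ ⟨j + 1, Nat.lt_of_succ_lt_succ hj⟩ (by simp)).comp (monoOn_of_mono _)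
      exact hmono _ (by rw [Category.assoc]; exact h)
    · intro h
      rw [← Category.assoc, h, zero_comp]

end ComposeShifted

section Towers

variable {C : Type u} [Category.{v} C] [Preadditive C] [HasZeroObject C] [HasShift C ℤ]
  [∀ n : ℤ, (shiftFunctor C n).Additive] [Pretriangulated C] {t : C}

/-- The shifts of a morphism of a triangle are injective on `Hom(t, -)` if the shifts of the
middle term receive no nonzero morphism from `t`. -/
lemma monoOn_shift {a b c : C} {f : a ⟶ b} {g : b ⟶ c} {δ : c ⟶ a⟦(1 : ℤ)⟧}
    (h : Triangle.mk f g δ ∈ distTriang C) (n : ℤ) (hb : ∀ u : t ⟶ b⟦n⟧, u = 0) :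
    MonoOn t (δ⟦n⟧') := by
  intro u hu
  obtain ⟨v, hv⟩ := Triangle.coyoneda_exact₃ _ (Triangle.shift_distinguished _ h n) u (by
    change u ≫ (n.negOnePow • δ⟦n⟧' ≫ (shiftFunctorComm C 1 n).hom.app a) = 0
    rw [Linear.comp_units_smul, ← Category.assoc, hu, zero_comp, smul_zero])
  rw [hv, hb v]
  exact zero_comp

end Towers

/-! ### The alternating sum of the indices in an angle -/

section AlternatingSum

lemma alternating_sum_telescope {G : Type*} [AddCommGroup G] {d : ℕ} (W : Fin (d + 1) → G) :
    ∑ i : Fin d, (-1 : ℤ) ^ ((i : ℕ) + 1) • (W i.succ + W i.castSucc) =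
      (-1 : ℤ) ^ d • W (Fin.last d) - W 0 := by
  let f : Fin (d + 1) → G := fun i => (-1 : ℤ) ^ (i : ℕ) • W i
  have h1 := Fin.sum_univ_succ f
  rw [Fin.sum_univ_castSucc f] at h1
  have h2 : ∀ i : Fin d, (-1 : ℤ) ^ ((i : ℕ) + 1) • (W i.succ + W i.castSucc) =
      f i.succ - f i.castSucc := by
    intro i
    simp only [f, Fin.val_succ, Fin.val_castSucc, smul_add, pow_succ, mul_neg, mul_one, neg_smul]
    abel
  simp only [h2, Finset.sum_sub_distrib]
  have h3 : f (Fin.last d) = (-1 : ℤ) ^ d • W (Fin.last d) := by simp [f]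
  have h4 : f 0 = W 0 := by simp [f]
  rw [← h3, ← h4, sub_eq_sub_iff_add_eq_add, add_comm, ← h1, add_comm]

variable {C : Type u} [Category.{v} C] [Preadditive C] [HasZeroObject C] [HasShift C ℤ]
  [∀ n : ℤ, (shiftFunctor C n).Additive] [Pretriangulated C] {t : C} {d : ℕ}
  {A : AngleSeq C d}

/-- Descending induction from w_d ≅ s_{d+1}: each triangle trades degree n of w_i for degree n + 1
of w_{i+1}, costing one degree per step. -/
lemma Tower.hom_w_shift_eq_zero (τ : Tower A) (h : ∀ i, ExtVanish t (d - 1) (A.obj i))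
    (i : Fin (d + 1)) : ∀ n : ℕ, 1 ≤ n → n + 1 ≤ i → ∀ u : t ⟶ (τ.w i)⟦(n : ℤ)⟧, u = 0 := by
  induction i using Fin.reverseInduction with
  | last =>
    intro n h1 h2
    have := τ.isIso_b
    rw [Fin.val_last] at h2
    exact hom_zero_of_iso ((shiftFunctor C (n : ℤ)).mapIso (asIso (τ.b (Fin.last d))))
      (h _ n h1 (by omega))
  | cast i ih =>
    intro n h1 h2
    rw [Fin.val_castSucc] at h2
    have := i.2
    exact hom_shift_zero₃ (τ.distinguished i) n (n + 1 : ℕ) (by push_cast; rfl)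
      (ih (n + 1) (by omega) (by rw [Fin.val_succ]; omega)) (h _ n h1 (by omega))

lemma Tower.nullOn_δ (τ : Tower A) (h : ∀ i, ExtVanish t (d - 1) (A.obj i)) (i : Fin d)
    (hi : 1 ≤ (i : ℕ)) : NullOn t (τ.δ i) := fun _ =>
  τ.hom_w_shift_eq_zero h i.succ 1 le_rfl (by rw [Fin.val_succ]; omega) _

/-- The kernel of Σ^i δ_i under F comes from Hom(t, Σ^i s_{i+1}), which vanishes for 1 ≤ i ≤ d - 1.
Thus F γ and F δ_0 have the same kernel. -/
lemma Tower.comp_conn_eq_zero_iff (τ : Tower A) (h : ∀ i, ExtVanish t (d - 1) (A.obj i))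
    (hd : 1 ≤ d) (u : t ⟶ τ.w 0) : u ≫ τ.a 0 ≫ A.conn = 0 ↔ u ≫ τ.δ ⟨0, hd⟩ = 0 := by
  have := τ.isIso_b
  have hmono : ∀ i : Fin d, 1 ≤ (i : ℕ) → MonoOn t ((τ.δ i)⟦((i : ℕ) : ℤ)⟧') := fun i hi =>
    monoOn_shift (τ.distinguished i) _ (h _ i hi (by have := i.2; omega))
  have key : u ≫ composeShifted τ.w τ.δ d (Nat.lt_succ_self d) = 0 ↔ u ≫ τ.δ ⟨0, hd⟩ = 0 := by
    obtain ⟨j, rfl⟩ : ∃ j, d = j + 1 := ⟨d - 1, by omega⟩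
    exact comp_composeShifted_eq_zero_iff hd hmono _ u
  rw [τ.conn_eq, ← key, ← Category.assoc]
  constructor
  · exact fun h => monoOn_of_mono _ _ h
  · intro h
    rw [h, zero_comp]

variable {G : Type*} [AddCommGroup G] {ind : C → G}

/-- Summing the defect formula over the triangles telescopes the indices of the w_i, and every
defect beyond the first vanishes because its δ_i is killed by F. -/
lemma Tower.alternating_sum (τ : Tower A) (hind : AdditiveOn t (fun _ => True) ind)
    (h : ∀ i, ExtVanish t (d - 1) (A.obj i)) (hd : 1 ≤ d) :
    ∑ i : Fin (d + 2), (-1 : ℤ) ^ (i : ℕ) • ind (A.obj i) = defect ind (τ.δ ⟨0, hd⟩) := by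
  have h1 : ∀ i : Fin d, ind (A.obj i.castSucc.succ) =
      (ind (τ.w i.succ) + ind (τ.w i.castSucc)) - defect ind (τ.δ i) := by
    intro i
    rw [defect_mor₃ hind (τ.distinguished i)]
    abel
  have h2 : ∀ i : Fin d, i ≠ ⟨0, hd⟩ → defect ind (τ.δ i) = 0 := by
    intro i hi
    have hi' : 1 ≤ (i : ℕ) := Nat.one_le_iff_ne_zero.2 fun h0 => hi (Fin.ext h0)
    rw [defect_mor₃ hind (τ.distinguished i),
      hind (τ.distinguished i) (τ.nullOn_δ h i hi') trivial trivial trivial]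
    abel
  have h3 : ind (A.obj 0) = ind (τ.w 0) :=
    have := τ.isIso_a
    (hind.map_iso (asIso (τ.a 0))).symm
  have h4 : ind (A.obj (Fin.last d).succ) = ind (τ.w (Fin.last d)) :=
    have := τ.isIso_b
    hind.map_iso (asIso (τ.b (Fin.last d)))
  have h5 : ∑ i : Fin d, (-1 : ℤ) ^ ((i : ℕ) + 1) • defect ind (τ.δ i) =
      - defect ind (τ.δ ⟨0, hd⟩) := by
    rw [Finset.sum_eq_single ⟨0, hd⟩]
    · simp
    · intro i _ hi
      rw [h2 i hi, smul_zero]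
    · simp
  rw [Fin.sum_univ_succ, Fin.sum_univ_castSucc, h3, h4]
  simp only [h1, Fin.val_succ, Fin.val_castSucc, Fin.val_last, smul_sub, Finset.sum_sub_distrib]
  rw [alternating_sum_telescope (fun i => ind (τ.w i)), h5]
  simp only [Fin.val_zero, pow_zero, one_smul, pow_succ, mul_neg, mul_one, neg_smul]
  abel

end AlternatingSum

/-! ### Angles from sequences of triangles -/

section Construction

variable {C : Type u} [Category.{v} C]

/-- Prepend an object to a sequence of objects. -/
def consObj (x : C) (f : ℕ → C) : ℕ → C
  | 0 => x
  | n + 1 => f n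

/-- The iterates of an operation on objects. -/
def iterObj (K : C → C) (x : C) : ℕ → C
  | 0 => x
  | n + 1 => K (iterObj K x n)

variable {w o : ℕ → C}

/-- The morphisms from the vertices of the tower to the objects of the sequence. -/
def towerMap (a : ∀ i, w (i + 1) ⟶ o i) : ∀ i, w i ⟶ consObj (w 0) o i
  | 0 => 𝟙 _
  | i + 1 => a i

variable [HasShift C ℤ]

/-- The sequence obtained by splicing triangles `w_{i+1} ⟶ o_i ⟶ w_i ⟶ Σ w_{i+1}`. -/
def spliceSeq (a : ∀ i, w (i + 1) ⟶ o i) (b : ∀ i, o i ⟶ w i)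
    (δ : ∀ i, w i ⟶ (w (i + 1))⟦(1 : ℤ)⟧) (d : ℕ) [hb : IsIso (b d)] : AngleSeq C d where
  obj i := consObj (w 0) o i
  map i := b i ≫ towerMap a i
  conn := composeShifted (d := d) (fun i => w i) (fun i => δ i) d (Nat.lt_succ_self d) ≫
    (shiftFunctor C (d : ℤ)).map (@inv _ _ _ _ (b d) hb)

variable [Preadditive C] [HasZeroObject C] [∀ n : ℤ, (shiftFunctor C n).Additive]
  [Pretriangulated C]

/-- The tower of the sequence `spliceSeq`. -/
def spliceTower {a : ∀ i, w (i + 1) ⟶ o i} {b : ∀ i, o i ⟶ w i}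
    {δ : ∀ i, w i ⟶ (w (i + 1))⟦(1 : ℤ)⟧}
    (h : ∀ i, Triangle.mk (a i) (b i) (δ i) ∈ distTriang C) (d : ℕ) [hb : IsIso (b d)] :
    Tower (spliceSeq a b δ d) where
  w i := w i
  a i := towerMap a i
  b i := b i
  δ i := δ i
  isIso_a := inferInstanceAs (IsIso (𝟙 (w 0)))
  isIso_b := hb
  distinguished i := h i
  comm _ := rfl
  conn_eq := Category.id_comp (spliceSeq a b δ d).conn

end Construction

/-! ### The index of the objects of a cluster tilting subcategory -/

section ClusterTilting

variable {C : Type u} [Category.{v} C] [Preadditive C] [HasShift C ℤ]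

lemma IsClusterTilting.iff_extVanish {n : ℕ} {P : ObjectProperty C} (h : IsClusterTilting n P)
    (c : C) : P c ↔ ∀ p, P p → ExtVanish p (n - 1) c := by
  rw [h.2.1 c]
  refine forall₂_congr fun p _ => ⟨fun H i h1 h2 => H i h1 (by omega), fun H i h1 h2 => H i h1 ?_⟩
  omega

lemma ExtVanish.source_of_addClosure [HasFiniteBiproducts C] {t : C} {j : ℕ} {c p : C}
    (h : ExtVanish t j c) (hp : addClosure t p) : ExtVanish p j c := fun i h1 h2 f =>
  NullOn.eq_zero (fun g => h i h1 h2 (g ≫ f)) hp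

lemma IsClusterTilting.addClosure_iff [HasFiniteBiproducts C] {t : C} {n : ℕ}
    (h : IsClusterTilting n (addClosure t)) (c : C) :
    ExtVanish t (n - 1) c ↔ addClosure t c :=
  ⟨fun hc => (h.iff_extVanish c).2 fun _ hp => hc.source_of_addClosure hp,
    fun hc => (h.iff_extVanish c).1 hc t (addClosure_self t)⟩

variable [HasZeroObject C] [∀ n : ℤ, (shiftFunctor C n).Additive] [Pretriangulated C]

lemma FunctoriallyFinite.hasPrecovers {t : C}
    (h : FunctoriallyFinite (addClosure t)) : HasPrecovers t := fun c => by
  obtain ⟨p, f, hp, hf⟩ := h.1 c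
  exact ⟨p, f, hp, fun g => hf t g (addClosure_self t)⟩

lemma IsClusterTilting.of_addClosure {t : C} {n : ℕ} {S : ObjectProperty C}
    (h : IsClusterTilting n S) (ht : S t) {c : C} (hc : addClosure t c) : S c :=
  (h.iff_extVanish c).2 fun p hp => ExtVanish.of_addClosure ((h.iff_extVanish t).1 ht p hp) hc

variable {t : C} {d : ℕ} {S : ObjectProperty C}

/-- Iterated right minimal precovers give the resolution, and each τ_i is radical because it is
killed by the next minimal morphism. -/
lemma exists_isIndexOf [IsIdempotentComplete C] (k : Type w) [Field k] [Linear k C]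
    [∀ X Y : C, Module.Finite k (X ⟶ Y)] (hd : 1 ≤ d) (hp : HasPrecovers t)
    (hN : ∀ c, ExtVanish t (2 * d - 1) c ↔ addClosure t c)
    (hTS : ∀ c, addClosure t c → S c) {s : C} (hs : S s) (hst : ExtVanish t (d - 1) s) :
    ∃ x, IsIndexOf S (addClosure t) d s x := by
  have happ : ∀ c : C, ∃ (a p : C) (f : a ⟶ p) (g : p ⟶ c) (δ : c ⟶ a⟦(1 : ℤ)⟧),
      addClosure t p ∧ EpiOn t g ∧ RightMinimal g ∧ Triangle.mk f g δ ∈ distTriang C := by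
    intro c
    obtain ⟨p, g, h1, h2, h3⟩ := exists_minimal_precover k (hp c)
    obtain ⟨a, f, δ, h⟩ := exists_fiber g
    exact ⟨a, p, f, g, δ, h1, h2, h3, h⟩
  choose K P f g δ hP hepi hmin hT using happ
  let w : ℕ → C := iterObj K s
  have ht : ExtVanish t (2 * d - 1) t := (hN t).2 (addClosure_self t)
  have hw : ∀ j, d - 1 + j ≤ 2 * d - 1 → ExtVanish t (d - 1 + j) (w j) := by
    intro j
    induction j with
    | zero => exact fun _ => hst
    | succ j ih =>
      intro hj
      exact ExtVanish.fiber (hT (w j)) ((nullOn_iff_epiOn (hT _)).2 (hepi _))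
        (ExtVanish.of_addClosure (ht.mono hj) (hP _)) (ih (by omega))
  -- Starting with d - 1 vanishing degrees for s, d fibres give the 2d - 1 degrees that characterise
  -- add(t). The precover of w_d then splits, hence is an isomorphism by minimality, and closes the
  -- tower.
  have hwd : addClosure t (w d) := (hN _).1 ((hw d (by omega)).mono (by omega))
  obtain ⟨σ, hσ⟩ := (hepi (w d)).exists_lift hwd (𝟙 _)
  have hb : IsIso (g (w d)) := (hmin _).isIso hσ
  let o : ℕ → C := fun i => P (w i)
  let a : ∀ i, w (i + 1) ⟶ o i := fun i => f (w i)
  let b : ∀ i, o i ⟶ w i := fun i => g (w i)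
  let η : ∀ i, w i ⟶ (w (i + 1))⟦(1 : ℤ)⟧ := fun i => δ (w i)
  have hTr : ∀ i, Triangle.mk (a i) (b i) (η i) ∈ distTriang C := fun i => hT (w i)
  have hb' : IsIso (b d) := hb
  let A : AngleSeq C d := spliceSeq a b η d
  let τ : Tower A := spliceTower hTr d
  have hA : ∀ i : Fin (d + 1), addClosure t (A.obj i.succ) := fun i => hP (w i)
  refine ⟨_, A, hA, ⟨fun i => ?_, ⟨τ⟩⟩, ⟨Iso.refl _⟩, fun i => ?_, rfl⟩
  · induction i using Fin.cases with
    | zero => exact hs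
    | succ i => exact hTS _ (hA i)
  · change InRadical (b (i + 1) ≫ a i)
    refine (hmin (w i)).inRadical ?_
    change (b (i + 1) ≫ a i) ≫ b i = 0
    rw [Category.assoc, comp_zero₁₂ (hTr i), comp_zero]

/-- The last object is in add(t) and 1 ≤ d ≤ 2d - 1, so F kills the last morphism of the angle. The
defect vanishes and the alternating sum can be solved for ind(s). Radicality plays no role. -/
lemma IsIndexOf.eq_index {ind : C → SplitK0 (addClosure t)}
    (hind : AdditiveOn t (fun _ => True) ind)
    (hcls : ∀ c (hc : addClosure t c), ind c = SplitK0.cls c hc) (hd : 1 ≤ d)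
    (hN : ∀ c, ExtVanish t (2 * d - 1) c ↔ addClosure t c)
    (hS : ∀ c, S c → ExtVanish t (d - 1) c) {s : C} {x : SplitK0 (addClosure t)}
    (hx : IsIndexOf S (addClosure t) d s x) : x = ind s := by
  obtain ⟨A, hA, ⟨hAS, ⟨τ⟩⟩, ⟨e⟩, -, rfl⟩ := hx
  have hE : ∀ i, ExtVanish t (d - 1) (A.obj i) := fun i => hS _ (hAS i)
  have h0 : NullOn t (τ.δ ⟨0, hd⟩) := by
    intro u
    refine (τ.comp_conn_eq_zero_iff hE hd u).1 ?_
    exact (hN _).2 (hA (Fin.last d)) d hd (by omega) _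
  have hdef : defect ind (τ.δ ⟨0, hd⟩) = 0 := by
    rw [defect_mor₃ hind (τ.distinguished _), hind (τ.distinguished _) h0 trivial trivial trivial]
    abel
  have hsum := τ.alternating_sum hind hE hd
  rw [hdef, Fin.sum_univ_succ, hind.map_iso e, Fin.val_zero, pow_zero, one_smul,
    add_eq_zero_iff_eq_neg, ← Finset.sum_neg_distrib] at hsum
  rw [hsum]
  refine Finset.sum_congr rfl fun i _ => ?_
  rw [Fin.val_succ, pow_succ, mul_neg, mul_one, neg_smul, neg_neg, hcls _ (hA i)]

/-- Every morphism in a `d`-cluster tilting subcategory occurs as the morphism `s_1 ⟶ s_0` of an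
angle; in particular the last morphism of the angle has it as a weak kernel. -/
lemma exists_angle (hd : 1 ≤ d) (hS : IsClusterTilting d S) {x y : C} (hx : S x) (hy : S y)
    (q : y ⟶ x) :
    ∃ (A : AngleSeq C d) (e : x ≅ A.obj 0), IsAngle S A ∧
      ∀ t : C, S t → ∀ u : t ⟶ x, u ≫ e.hom ≫ A.conn = 0 ↔ ∃ v, v ≫ q = u := by
  have happ : ∀ c : C, ∃ (a p : C) (f : a ⟶ p) (g : p ⟶ c) (δ : c ⟶ a⟦(1 : ℤ)⟧),
      S p ∧ (∀ r, S r → EpiOn r g) ∧ (S c → IsIso g) ∧ Triangle.mk f g δ ∈ distTriang C := by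
    intro c
    -- For objects already in S the identity is chosen as approximation, so that the d-th one is an
    -- isomorphism and the tower can end there.
    by_cases hc : S c
    · obtain ⟨a, f, δ, h⟩ := exists_fiber (𝟙 c)
      exact ⟨a, c, f, 𝟙 c, δ, hc, fun r _ u => ⟨u, Category.comp_id u⟩,
        fun _ => inferInstance, h⟩
    · obtain ⟨p, g, hp, hg⟩ := hS.1.1 c
      obtain ⟨a, f, δ, h⟩ := exists_fiber g
      exact ⟨a, p, f, g, δ, hp, fun r hr u => hg r u hr, fun h => absurd h hc, h⟩
  choose K P f g δ hP hepi hiso hT using happ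
  obtain ⟨z, f₁, δ₁, h₁⟩ := exists_fiber q
  let w : ℕ → C := consObj x (iterObj K z)
  let o : ℕ → C := consObj y (fun n => P (w (n + 1)))
  let a : ∀ i, w (i + 1) ⟶ o i := fun i => match i with
    | 0 => f₁
    | n + 1 => f (w (n + 1))
  let b : ∀ i, o i ⟶ w i := fun i => match i with
    | 0 => q
    | n + 1 => g (w (n + 1))
  let η : ∀ i, w i ⟶ (w (i + 1))⟦(1 : ℤ)⟧ := fun i => match i with
    | 0 => δ₁
    | n + 1 => δ (w (n + 1))
  have hTr : ∀ i, Triangle.mk (a i) (b i) (η i) ∈ distTriang C := fun i => match i with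
    | 0 => h₁
    | n + 1 => hT (w (n + 1))
  have ho : ∀ i, S (o i) := fun i => match i with
    | 0 => hy
    | n + 1 => hP (w (n + 1))
  have hw : ∀ r, S r → ∀ j, j ≤ d - 1 → ExtVanish r j (w (j + 1)) := by
    intro r hr j
    induction j with
    | zero => exact fun _ i h1 h2 => absurd h1 (by omega)
    | succ j ih =>
      intro hj
      exact ExtVanish.fiber (hTr (j + 1)) ((nullOn_iff_epiOn (hTr _)).2 (hepi _ r hr))
        (((hS.iff_extVanish _).1 (hP _) r hr).mono hj) (ih (by omega))
  have hb : IsIso (b d) := by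
    obtain ⟨j, rfl⟩ : ∃ j, d = j + 1 := ⟨d - 1, by omega⟩
    exact hiso _ ((hS.iff_extVanish _).2 fun r hr => hw r hr j le_rfl)
  let A : AngleSeq C d := spliceSeq a b η d
  have hA : ∀ i, S (A.obj i) := by
    intro i
    induction i using Fin.cases with
    | zero => exact hx
    | succ i => exact ho i
  let τ : Tower A := spliceTower hTr d
  refine ⟨A, Iso.refl _, ⟨hA, ⟨τ⟩⟩, fun t ht u => ?_⟩
  have h := τ.comp_conn_eq_zero_iff (fun i => (hS.iff_extVanish _).1 (hA i) t ht) hd u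
  refine h.trans ⟨fun h0 => ?_, ?_⟩
  · obtain ⟨v, hv⟩ := Triangle.coyoneda_exact₃ _ h₁ u h0
    exact ⟨v, hv.symm⟩
  · rintro ⟨v, rfl⟩
    change (v ≫ q) ≫ δ₁ = 0
    rw [Category.assoc, comp_zero₂₃ h₁, comp_zero]

end ClusterTilting

/-! ### The main theorem -/

section Main

variable {C : Type u} [Category.{v} C] [Preadditive C] [HasZeroObject C] [HasShift C ℤ]
  [∀ n : ℤ, (shiftFunctor C n).Additive] [Pretriangulated C] {t : C} {d : ℕ}
  {S : ObjectProperty C}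

/-- An angle extending a presentation of M has F γ with kernel the image of that presentation, so Im
F γ is its cokernel M. -/
lemma exists_angle_imageF (k : Type w) [Field k] [Linear k C]
    [∀ X Y : C, Module.Finite k (X ⟶ Y)] (hd : 1 ≤ d) (hS : IsClusterTilting d S) (ht : S t)
    (M : FGModuleCat.{v} (End t)ᵐᵒᵖ) :
    ∃ A : AngleSeq C d, IsAngle S A ∧ K0.cls (imageF k t A.conn) = K0.cls M := by
  obtain ⟨n, m, f, φ, hφ, hf⟩ := exists_presentation k (t := t) M.obj
  obtain ⟨A, e, hA, h⟩ := exists_angle hd hS (hS.of_addClosure ht (addClosure_biproduct t n))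
    (hS.of_addClosure ht (addClosure_biproduct t m)) f
  refine ⟨A, hA, ?_⟩
  obtain ⟨ε⟩ := range_homMap_equiv_of_ker_eq A.conn (φ.comp (homMap t e.inv))
    (hφ.comp fun u => ⟨(show t ⟶ _ from u) ≫ e.hom, by
      change ((show t ⟶ _ from u) ≫ e.hom) ≫ e.inv = u
      rw [Category.assoc, e.hom_inv_id, Category.comp_id]⟩) (fun u => by
      refine Iff.trans ?_ (hf (u ≫ e.inv)).symm
      rw [← h t ht, Category.assoc, e.inv_hom_id_assoc])
  exact K0.cls_of_linearEquiv ε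

/-- The defect of δ_0 is θ of Im F δ_0, which is isomorphic to Im F γ since both morphisms have the
same kernel under F. -/
lemma Tower.alternating_sum_eq [IsTriangulated C] (k : Type w) [Field k] [Linear k C]
    [∀ X Y : C, Module.Finite k (X ⟶ Y)] {G : Type*} [AddCommGroup G] {ind : C → G}
    (hind : AdditiveOn t (fun _ => True) ind) {θ : K0.{v} (End t)ᵐᵒᵖ →+ G}
    (hθ : ∀ {c x : C} (g : c ⟶ x), θ (K0.cls (imageF k t g)) = defect ind g) {A : AngleSeq C d}
    (τ : Tower A) (h : ∀ i, ExtVanish t (d - 1) (A.obj i)) (hd : 1 ≤ d) :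
    ∑ i : Fin (d + 2), (-1 : ℤ) ^ (i : ℕ) • ind (A.obj i) = θ (K0.cls (imageF k t A.conn)) := by
  have := τ.isIso_a
  have e1 : defect ind (τ.a 0 ≫ A.conn) = defect ind A.conn :=
    defect_epi_comp hind (τ.a 0) (epiOn_of_isIso _) A.conn
  rw [τ.alternating_sum hind h hd, hθ, ← e1, ← hθ, ← hθ,
    cls_imageF_of_ker_eq k _ _ (τ.comp_conn_eq_zero_iff h hd)]
  rfl

end Main

end HigherIndex

end

theorem theoremA {k : Type*} [Field k] {C : Type*} [Category C] [Preadditive C] [Linear k C]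
    [HasZeroObject C] [HasShift C ℤ] [∀ n : ℤ, (shiftFunctor C n).Additive]
    [∀ n : ℤ, (shiftFunctor C n).Linear k] [Pretriangulated C] [IsTriangulated C]
    [IsIdempotentComplete C] [∀ X Y : C, Module.Finite k (X ⟶ Y)]
    (d : ℕ) (hd : 1 ≤ d)
    (S : ObjectProperty C) (hS : HigherIndex.IsClusterTilting d S)
    (hSshift : ∀ c : C, S c ↔ S (c⟦(d : ℤ)⟧))
    (t : C) (htS : S t) (ht : HigherIndex.IsClusterTilting (2 * d) (HigherIndex.addClosure t)) :
    (∀ s : C, S s → ∃! x, HigherIndex.IsIndexOf S (HigherIndex.addClosure t) d s x) ∧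
    ∃! θ : HigherIndex.K0 (End t)ᵐᵒᵖ →+ HigherIndex.SplitK0 (HigherIndex.addClosure t),
      ∀ A : HigherIndex.AngleSeq C d, HigherIndex.IsAngle S A →
        ∑ i : Fin (d + 2), (-1 : ℤ) ^ (i : ℕ) •
            HigherIndex.index S (HigherIndex.addClosure t) d (A.obj i) =
          θ (HigherIndex.K0.cls (HigherIndex.imageF k t A.conn)) := by
  have hTS : ∀ c, HigherIndex.addClosure t c → S c := fun c hc => hS.of_addClosure htS hc
  have hp := ht.1.hasPrecovers
  have hN := ht.addClosure_iff
  have hSt : ∀ c, S c → HigherIndex.ExtVanish t (d - 1) c := fun c hc =>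
    (hS.iff_extVanish c).1 hc t htS
  have hrigid : HigherIndex.ExtVanish t 1 t :=
    ((hN t).2 (HigherIndex.addClosure_self t)).mono (by omega)
  obtain ⟨ind, hcls, hind⟩ := HigherIndex.exists_index hp hN
  obtain ⟨θ, hθ⟩ := HigherIndex.exists_theta k hind hp hrigid
  have hex : ∀ s : C, S s → ∃ x, HigherIndex.IsIndexOf S (HigherIndex.addClosure t) d s x :=
    fun s hs => HigherIndex.exists_isIndexOf k hd hp hN hTS hs (hSt s hs)
  have huniq : ∀ {s : C} {x}, HigherIndex.IsIndexOf S (HigherIndex.addClosure t) d s x →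
      x = ind s := fun hx => hx.eq_index hind hcls hd hN hSt
  have hindex : ∀ s : C, S s → HigherIndex.index S (HigherIndex.addClosure t) d s = ind s :=
    fun s hs => huniq (Classical.epsilon_spec (hex s hs))
  refine ⟨fun s hs => ?_, θ, fun A hA => ?_, fun θ' hθ' => ?_⟩
  · obtain ⟨x, hx⟩ := hex s hs
    exact ⟨x, hx, fun y hy => (huniq hy).trans (huniq hx).symm⟩
  · obtain ⟨τ⟩ := hA.2
    rw [← τ.alternating_sum_eq k hind hθ (fun i => hSt _ (hA.1 i)) hd]
    exact Finset.sum_congr rfl fun i _ => by rw [hindex _ (hA.1 i)]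
  -- Every class [M] is some [Im F γ], where the angle formula dictates the value of any candidate
  -- θ'.
  · refine HigherIndex.K0.hom_ext fun M => ?_
    obtain ⟨A, hA, hM⟩ := HigherIndex.exists_angle_imageF k hd hS htS M
    obtain ⟨τ⟩ := hA.2
    rw [← hM, ← hθ' A hA, ← τ.alternating_sum_eq k hind hθ (fun i => hSt _ (hA.1 i)) hd]
    exact Finset.sum_congr rfl fun i _ => by rw [hindex _ (hA.1 i)]
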